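/- Let $N \ge 0$ and let $\mathcal A = \{1,\dots,N\} \sqcup \{\bar 1,\dots,\bar N\}$ be the alphabet of unbarred and barred letters. Let $\lessdot$ be a shuffle order on $\mathcal A$, i.e. a total order with $1 \lessdot 2 \lessdot \cdots \lessdot N$ and $\bar 1 \lessdot \bar 2 \lessdot \cdots \lessdot \bar N$. Let $\mathcal U$ be the free associative $\mathbb Z$-algebra on the noncommuting variables $u_x$, $x \in \mathcal A$, in which a word $w_1 \cdots w_t$ in the alphabet $\mathcal A$ is identified with the monomial $u_{w_1} \cdots u_{w_t}$. The $\lessdot$-colored plactic algebra $\mathcal U / I^{\lessdot}_{\mathrm{plac}}$ is the quotient of $\mathcal U$ by the two-sided ideal generated by the relations - $xzy = zxy$ and $yxz = yzx$ for $x \lessdot y \lessdot z$ in $\mathcal A$; - $yyx = yxy$ for $x \lessdot y$ and $zyy = yzy$ for $y \lessdot z$, where $y$ is unbarred; - $yyz = yzy$ for $y \lessdot z$ and $xyy = yxy$ for $x \lessdot y$, where $y$ is barred. For $k \ge 1$ let $e^{\lessdot}_k(\mathbf u) = \sum u_{z_1} u_{z_2} \cdots u_{z_k}$, summed over all $z_1,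 \dots, z_k \in \mathcal A$ such that for every $1 \le i < k$ either $z_{i+1} \lessdot z_i$, or $z_i$ and $z_{i+1}$ are equal barred letters; put $e^{\lessdot}_0(\mathbf u) = 1$ and $e^{\lessdot}_k(\mathbf u) = 0$ for $k < 0$. For a partition $\nu$ with conjugate partition $\nu'$ and $t = \nu_1$, the noncommutative super Schur function is $$\mathfrak J^{\lessdot}_\nu(\mathbf u) = \sum_{\pi \in S_t} \operatorname{sgn}(\pi)\, e^{\lessdot}_{\nu'_1 + \pi(1) - 1}(\mathbf u)\, e^{\lessdot}_{\nu'_2 + \pi(2) - 2}(\mathbf u) \cdots e^{\lessdot}_{\nu'_t + \pi(t) - t}(\mathbf u) \in \mathcal U .$$ A $\lessdot$-colored tableau of shape $\nu$ is a filling of the Young diagram of $\nu$ (in English notation) by letters of $\mathcal A$ such that each row and each column is weakly increasing for $\lessdot$, while the unbarred letters in each column and the barred letters in each row are strictly increasing. Let $\mathrm{CT}^{\lessdot}_\nu$ be the set of these tableaux. The column reading word $\mathrm{creading}(T)$ is obtained by concatenating the columns of $T$ from left to right, each read from bottom to top. **Theorem.** For every shuffle order $\lessdot$ on $\mathcal A$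 and every partition $\nu$, $$\mathfrak J^{\lessdot}_\nu(\mathbf u) = \sum_{T \in \mathrm{CT}^{\lessdot}_\nu} \mathrm{creading}(T) \qquad \text{in } \mathcal U / I^{\lessdot}_{\mathrm{plac}} .$$ -/

import Mathlib

namespace SuperSchur

/-- The alphabet `{1, …, N} ⊔ {1̄, …, N̄}`: the summand `Sum.inl a` is the unbarred letter `a`,
and `Sum.inr a` is the barred letter `ā` (with `Fin N` standing for `{1, …, N}`). -/
abbrev Letter (N : ℕ) : Type := Fin N ⊕ Fin N

/-- A colored word is a word in the alphabet of all letters. -/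
abbrev ColoredWord (N : ℕ) : Type := List (Letter N)

/-- `lt` is (the strict part of) a shuffle order: a total order on the alphabet
that restricts to the usual order on the unbarred letters and on the barred letters. -/
structure IsShuffleOrder {N : ℕ} (lt : Letter N → Letter N → Prop) : Prop where
  irrefl : ∀ x, ¬ lt x x
  trans : ∀ x y z, lt x y → lt y z → lt x z
  total : ∀ x y, lt x y ∨ x = y ∨ lt y x
  unbarred_lt : ∀ a b : Fin N, a < b → lt (Sum.inl a) (Sum.inl b)
  barred_lt : ∀ a b : Fin N, a < b → lt (Sum.inr a) (Sum.inr b)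

/-- The free associative `ℤ`-algebra on noncommuting variables indexed by the letters. -/
abbrev U (N : ℕ) : Type := FreeAlgebra ℤ (Letter N)

/-- The monomial `u_{w₁} ⋯ u_{wₜ}` of a colored word `w = w₁ ⋯ wₜ`. -/
noncomputable def monomial {N : ℕ} (w : ColoredWord N) : U N :=
  (w.map (FreeAlgebra.ι ℤ)).prod

/-- The defining relations of the colored plactic algebra. -/
inductive PlacticRel {N : ℕ} (lt : Letter N → Letter N → Prop) : U N → U N → Prop
  | xzy_zxy (x y z : Letter N) : lt x y → lt y z →
      PlacticRel lt (monomial [x, z, y]) (monomial [z, x, y])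
  | yxz_yzx (x y z : Letter N) : lt x y → lt y z →
      PlacticRel lt (monomial [y, x, z]) (monomial [y, z, x])
  | unbarred_yyx (x : Letter N) (b : Fin N) : lt x (Sum.inl b) →
      PlacticRel lt (monomial [Sum.inl b, Sum.inl b, x]) (monomial [Sum.inl b, x, Sum.inl b])
  | unbarred_zyy (z : Letter N) (b : Fin N) : lt (Sum.inl b) z →
      PlacticRel lt (monomial [z, Sum.inl b, Sum.inl b]) (monomial [Sum.inl b, z, Sum.inl b])
  | barred_yyz (z : Letter N) (b : Fin N) : lt (Sum.inr b) z →
      PlacticRel lt (monomial [Sum.inr b, Sum.inr b, z]) (monomial [Sum.inr b, z, Sum.inr b])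
  | barred_xyy (x : Letter N) (b : Fin N) : lt x (Sum.inr b) →
      PlacticRel lt (monomial [x, Sum.inr b, Sum.inr b]) (monomial [Sum.inr b, x, Sum.inr b])

/-- The colored plactic algebra: the quotient of `U N` by the two-sided ideal generated by
the colored plactic relations. -/
abbrev PlacticAlgebra {N : ℕ} (lt : Letter N → Letter N → Prop) : Type :=
  RingQuot (PlacticRel lt)

/-- The quotient map from `U N` to the colored plactic algebra. -/
noncomputable def toPlactic {N : ℕ} (lt : Letter N → Letter N → Prop) :
    U N →ₐ[ℤ] PlacticAlgebra lt :=
  RingQuot.mkAlgHom ℤ (PlacticRel lt)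

/-- `ColGT lt y x`: either `y` is greater than `x`, or `y` and `x` are equal barred letters. -/
def ColGT {N : ℕ} (lt : Letter N → Letter N → Prop) (y x : Letter N) : Prop :=
  lt x y ∨ (y = x ∧ y.isRight = true)

open Classical in
/-- The noncommutative super elementary symmetric function `e_k` for an integer `k`: the sum of the
monomials of the words `z₁ ⋯ z_k` with `ColGT lt zᵢ zᵢ₊₁` for all `i < k`
(which is `1` for `k = 0`), and `0` for `k < 0`. -/
noncomputable def elementary {N : ℕ} (lt : Letter N → Letter N → Prop) : ℤ → U N
  | Int.ofNat k =>
      ∑ z : Fin k → Letter N with (List.ofFn z).IsChain (ColGT lt), monomial (List.ofFn z)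
  | Int.negSucc _ => 0

/-- The noncommutative super Schur function of a partition `ν`, given as a Young diagram (with
`ν.rowLen 0` columns, of lengths `ν.colLen j`):
`∑_π sgn(π) e_{ν'₁ + π(1) - 1} ⋯ e_{ν'ₜ + π(t) - t}`, the product being taken from left to right. -/
noncomputable def superSchur {N : ℕ} (lt : Letter N → Letter N → Prop) (ν : YoungDiagram) : U N :=
  ∑ π : Equiv.Perm (Fin (ν.rowLen 0)),
    ((Equiv.Perm.sign π : ℤˣ) : ℤ) •
      (List.ofFn fun j : Fin (ν.rowLen 0) =>
        elementary lt ((ν.colLen j : ℤ) + ((π j : ℕ) : ℤ) - ((j : ℕ) : ℤ))).prod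

/-- A filling `T` of the cells `(row, column)` of `ν` by letters is a colored tableau: rows and
columns are weakly increasing, and the unbarred letters in each column and the barred letters in
each row are strictly increasing. -/
structure IsColoredTableau {N : ℕ} (lt : Letter N → Letter N → Prop) (ν : YoungDiagram)
    (T : ν.cells → Letter N) : Prop where
  row_weak : ∀ c d : ν.cells, c.1.1 = d.1.1 → c.1.2 < d.1.2 → lt (T c) (T d) ∨ T c = T d
  col_weak : ∀ c d : ν.cells, c.1.2 = d.1.2 → c.1.1 < d.1.1 → lt (T c) (T d) ∨ T c = T d
  row_strict : ∀ c d : ν.cells, c.1.1 = d.1.1 → c.1.2 < d.1.2 →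
    (T c).isRight = true → (T d).isRight = true → lt (T c) (T d)
  col_strict : ∀ c d : ν.cells, c.1.2 = d.1.2 → c.1.1 < d.1.1 →
    (T c).isLeft = true → (T d).isLeft = true → lt (T c) (T d)

open Classical in
/-- The finite set of colored tableaux of shape `ν`. -/
noncomputable def coloredTableaux {N : ℕ} (lt : Letter N → Letter N → Prop) (ν : YoungDiagram) :
    Finset (ν.cells → Letter N) :=
  {T | IsColoredTableau lt ν T}

/-- The column reading word: concatenate the columns from left to right, each read
from bottom to top. -/
def columnReading {N : ℕ} {ν : YoungDiagram} (T : ν.cells → Letter N) : ColoredWord N :=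
  (List.ofFn fun j : Fin (ν.rowLen 0) =>
    List.ofFn fun i : Fin (ν.colLen j) =>
      T ⟨((i.rev : ℕ), (j : ℕ)), YoungDiagram.mem_iff_lt_colLen.mpr i.rev.isLt⟩).flatten

end SuperSchur

namespace SuperSchur

/-! The argument is a sign-reversing cancellation in the determinant, made possible by the plactic
relations. Write `G y x` when `y` may stand directly below `x`; then `¬ G x y` means that `y` may
stand directly to the right of `x`. In this language the barred and unbarred cases merge, and the
six families of relations become the two rules of `KnuthRelations`.

The first ingredient is that the elementary functions commute, even when the letters are restricted
to a set closed under `below` (`columnSum_commute`). Hence the factors of each determinant term can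
be rearranged, and the sum becomes one over `σ` of products whose `j`-th factor has degree `γ (σ j)
+ j`, where `γ j = ν'_j - j` with columns numbered from 0. Such a product is a sum over tuples of
columns with these lengths.

If a tuple violates the row condition, take the topmost row `r` with a violation and the rightmost
violation in it, between columns `C` and `D`. Let `d` be the entry of `D` in row `r`. The part of
`C` from row `r` on and the part of `D` strictly below row `r` are both arbitrary columns over the
letters allowed below `d`. The Knuth relations bring their two sums next to each other, where they
commute, so exchanging their lengths does not change the total (`failingSum_comm`). The lengths `(a,
b)` become `(b - 1, a + 1)`, which is the effect of composing `σ` with an adjacent transposition, so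
these terms cancel in pairs (`sum_sign_selectedAt`).

The tuples satisfying every row condition remain. Their column lengths decrease weakly, and since
`γ` is strictly decreasing this forces `σ = 1`. What is left is the sum over tableaux. -/

/-- The axioms on "`y` may be placed below `x` in a column" (`G y x`) under which the theory of
noncommutative Schur functions works; `¬ G x y` says that `y` may be placed to the right
of `x` in a row. -/
structure IsColumnOrder {A : Type*} (G : A → A → Prop) : Prop where
  trans : ∀ {x y z}, G x y → G y z → G x z
  cotrans : ∀ {x y z}, ¬ G x y → ¬ G y z → ¬ G x z
  antisymm : ∀ {x y}, G x y → G y x → x = y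
  connected : ∀ {x y}, x ≠ y → G x y ∨ G y x

/-- The Knuth relations for a family of ring elements. -/
structure KnuthRelations {A Q : Type*} [Ring Q] (G : A → A → Prop) (u : A → Q) : Prop where
  swap_left : ∀ {x y z}, ¬ G x y → G z y → u x * u z * u y = u z * u x * u y
  swap_right : ∀ {x y z}, G y x → ¬ G y z → u y * u x * u z = u y * u z * u x

/-! ### Knuth moves on words: sliding letters past columns. -/

section Words

variable {A Q : Type*} [Ring Q] {G : A → A → Prop} {u : A → Q}

theorem IsColumnOrder.mix_left (hG : IsColumnOrder G) {x y z : A} (h : ¬ G x y) (h' : G z y) :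
    G z x := by
  by_contra h''
  exact hG.cotrans h'' h h'

theorem IsColumnOrder.mix_right (hG : IsColumnOrder G) {x y z : A} (h : ¬ G x y) (h' : G z y) :
    ¬ G x z := fun h'' => h (hG.trans h'' h')

/-- The product of the variables along a word. -/
def wordProd (u : A → Q) (w : List A) : Q := (w.map u).prod

@[simp] theorem wordProd_nil : wordProd u [] = 1 := by simp [wordProd]

@[simp] theorem wordProd_cons (x : A) (w : List A) :
    wordProd u (x :: w) = u x * wordProd u w := by simp [wordProd]

@[simp] theorem wordProd_append (v w : List A) :
    wordProd u (v ++ w) = wordProd u v * wordProd u w := by simp [wordProd]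

/-- The first word can be placed letter by letter to the left of a prefix of the second one. -/
def RowPaired (G : A → A → Prop) : List A → List A → Prop
  | [], _ => True
  | _ :: _, [] => False
  | y :: Y, z :: Z => ¬ G y z ∧ RowPaired G Y Z

theorem RowPaired.shift (hG : IsColumnOrder G) {Y Z : List A} {z : A} (h : RowPaired G Y Z)
    (hz : (z :: Z).IsChain G) : RowPaired G Y (z :: Z) := by
  induction Y generalizing Z z with
  | nil => trivial
  | cons y Y ih =>
    cases Z with
    | nil => exact h.elim
    | cons z' Z =>
      rw [List.isChain_cons_cons] at hz
      exact ⟨hG.mix_right h.1 hz.1, ih h.2 hz.2⟩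

theorem RowPaired.of_append {Y Y' Z : List A} (h : RowPaired G (Y ++ Y') Z) :
    RowPaired G Y Z := by
  induction Y generalizing Z with
  | nil => trivial
  | cons y Y ih =>
    cases Z with
    | nil => exact h.elim
    | cons z Z => exact ⟨h.1, ih h.2⟩

/-- Words are read from bottom to top. The first letter of `Z` is brought next to `w`, because the
tail of `Y` can be exchanged with either of them by induction. Then `swap_left` moves `w` past the
first letter of `Y`, and the other exchange is undone. -/
theorem wordProd_mul_comm_of_rowPaired (hG : IsColumnOrder G) (hu : KnuthRelations G u)
    {Y Z : List A} {w : A} (h : RowPaired G Y Z) (hw : (w :: Z).IsChain G) :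
    wordProd u Y * u w * wordProd u Z = u w * wordProd u Y * wordProd u Z := by
  induction Y generalizing Z w with
  | nil => simp
  | cons y Y ih =>
    cases Z with
    | nil => exact h.elim
    | cons z Z =>
      rw [List.isChain_cons_cons] at hw
      have h1 := ih (h.2.shift hG hw.2) (List.isChain_cons_cons.2 hw)
      have h2 := ih h.2 hw.2
      have h3 := hu.swap_left h.1 hw.1
      simp only [wordProd_cons] at h1 ⊢
      calc u y * wordProd u Y * u w * (u z * wordProd u Z)
          = u y * (wordProd u Y * u w * (u z * wordProd u Z)) := by noncomm_ring
        _ = u y * u w * (wordProd u Y * u z * wordProd u Z) := by rw [h1]; noncomm_ring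
        _ = (u y * u w * u z) * (wordProd u Y * wordProd u Z) := by rw [h2]; noncomm_ring
        _ = u w * u y * (u z * wordProd u Y * wordProd u Z) := by rw [h3]; noncomm_ring
        _ = _ := by rw [← h2]; noncomm_ring

/-- The letter `z` moves left through the column by repeated `swap_right`; transitivity of `G` keeps
the hypothesis on `z` valid for each letter of the column. -/
theorem mul_wordProd_mul_of_isChain (hG : IsColumnOrder G) (hu : KnuthRelations G u)
    {Y : List A} {y z : A} (hy : (y :: Y).IsChain G) (hz : ¬ G y z) :
    u y * wordProd u Y * u z = u y * u z * wordProd u Y := by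
  induction Y generalizing y with
  | nil => simp
  | cons y' Y ih =>
    rw [List.isChain_cons_cons] at hy
    have h1 := ih hy.2 (fun h => hz (hG.trans hy.1 h))
    have h2 := hu.swap_right hy.1 hz
    simp only [wordProd_cons]
    calc u y * (u y' * wordProd u Y) * u z = u y * (u y' * wordProd u Y * u z) := by noncomm_ring
      _ = (u y * u y' * u z) * wordProd u Y := by rw [h1]; noncomm_ring
      _ = _ := by rw [h2]; noncomm_ring

/-- Each letter of `Z` can be pulled left to stand right after its partner in `Y`, whether or not
`x` lies between. Once all of `Z` has been absorbed in this way, the position of `x` no longer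
matters. -/
theorem wordProd_mul_comm_of_forall₂ (hG : IsColumnOrder G) (hu : KnuthRelations G u)
    {Y Z : List A} {x : A} (hY : (Y ++ [x]).IsChain G)
    (h : List.Forall₂ (fun y z => ¬ G y z) Y Z) :
    wordProd u Y * (u x * wordProd u Z) = wordProd u Y * (wordProd u Z * u x) := by
  induction h with
  | nil => simp
  | @cons y z Y Z hyz _ ih =>
    have h1 := mul_wordProd_mul_of_isChain hG hu (u := u) (Y := Y ++ [x]) hY hyz
    have h2 := mul_wordProd_mul_of_isChain hG hu (u := u) (Y := Y) (y := y) (z := z)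
      (List.IsChain.left_of_append (l₂ := [x]) hY) hyz
    have h3 := ih (List.IsChain.tail hY)
    simp only [wordProd_append, wordProd_cons, wordProd_nil, mul_one] at h1 ⊢
    calc u y * wordProd u Y * (u x * (u z * wordProd u Z))
        = (u y * (wordProd u Y * u x) * u z) * wordProd u Z := by noncomm_ring
      _ = u y * u z * (wordProd u Y * (u x * wordProd u Z)) := by rw [h1]; noncomm_ring
      _ = (u y * u z * wordProd u Y) * (wordProd u Z * u x) := by rw [h3]; noncomm_ring
      _ = _ := by rw [← h2]; noncomm_ring

end Words

/-! ### Commutation of the elementary functions. -/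

section Elementary

variable {A Q : Type*} [Fintype A] [Ring Q] {G : A → A → Prop} [DecidableRel G] {u : A → Q}

/-- The letters that may be placed below `x` in a column. -/
def below (G : A → A → Prop) [DecidableRel G] (x : A) : Finset A := {y | G y x}

@[simp] theorem mem_below {x y : A} : y ∈ below G x ↔ G y x := by simp [below]

/-- The sum of the reading words of the columns of length `k` whose top entry is in `S`. -/
def columnSum (G : A → A → Prop) [DecidableRel G] (u : A → Q) : ℕ → Finset A → Q
  | 0, _ => 1
  | k + 1, S => ∑ x ∈ S, columnSum G u k (below G x) * u x

theorem columnSum_succ (k : ℕ) (S : Finset A) :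
    columnSum G u (k + 1) S = ∑ x ∈ S, columnSum G u k (below G x) * u x := rfl

@[simp] theorem columnSum_zero (S : Finset A) : columnSum G u 0 S = 1 := rfl

/-- The top letter `w` of each column is first attached to `Z`, so that the rest of the column
passes `Y` by induction; then `w` itself passes `Y`. -/
theorem wordProd_mul_columnSum (hG : IsColumnOrder G) (hu : KnuthRelations G u) (b : ℕ)
    {S : Finset A} {Y Z : List A} (h : RowPaired G Y Z) (hS : ∀ w ∈ S, (w :: Z).IsChain G) :
    wordProd u Y * columnSum G u b S * wordProd u Z =
      columnSum G u b S * wordProd u Y * wordProd u Z := by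
  induction b generalizing S Z with
  | zero => simp
  | succ b ih =>
    simp only [columnSum_succ, Finset.mul_sum, Finset.sum_mul]
    refine Finset.sum_congr rfl fun w hw => ?_
    have h1 := ih (S := below G w) (Z := w :: Z) (h.shift hG (hS w hw)) fun v hv =>
      List.isChain_cons_cons.2 ⟨mem_below.1 hv, hS w hw⟩
    have h2 := wordProd_mul_comm_of_rowPaired hG hu h (hS w hw)
    simp only [wordProd_cons] at h1
    calc wordProd u Y * (columnSum G u b (below G w) * u w) * wordProd u Z
        = wordProd u Y * columnSum G u b (below G w) * (u w * wordProd u Z) := by noncomm_ring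
      _ = columnSum G u b (below G w) * (wordProd u Y * u w * wordProd u Z) := by
        rw [h1]; noncomm_ring
      _ = _ := by rw [h2]; noncomm_ring

theorem columnSum_succ_split {S : Finset A} {d : A} (hS : below G d ⊆ S) (k : ℕ) :
    columnSum G u (k + 1) S = columnSum G u (k + 1) (below G d) +
      ∑ c ∈ S with ¬ G c d, columnSum G u k (below G c) * u c := by
  rw [columnSum_succ, ← Finset.sum_filter_add_sum_filter_not S (fun c => G c d)]
  congr 1
  rw [columnSum_succ]
  refine Finset.sum_congr ?_ fun _ _ => rfl
  ext c
  simp only [Finset.mem_filter, mem_below]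
  exact ⟨fun h => h.2, fun h => ⟨hS (mem_below.2 h), h⟩⟩

/-- The commutator of `u x` with two columns whose top rows have been fixed. -/
def columnCommutator (G : A → A → Prop) [DecidableRel G] (u : A → Q) (x : A) (Y Z : List A)
    (S S' : Finset A) (p q : ℕ) : Q :=
  columnSum G u p S * wordProd u Y * (u x * (columnSum G u q S' * wordProd u Z) -
    columnSum G u q S' * wordProd u Z * u x)

/-- The invariant of the row by row expansion of `columnCommutator`. -/
structure CommutatorInvariant (G : A → A → Prop) [DecidableRel G] (x : A) (Y Z : List A)
    (S S' : Finset A) : Prop where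
  forall₂ : List.Forall₂ (fun y z => ¬ G y z) Y Z
  chain : (Y ++ [x]).IsChain G
  paired : ∀ d ∈ S', RowPaired G (Y ++ [x]) (d :: Z)
  subset : ∀ d ∈ S', below G d ⊆ S
  chain_left : ∀ c ∈ S, (c :: (Y ++ [x])).IsChain G
  chain_right : ∀ d ∈ S', (d :: Z).IsChain G

theorem CommutatorInvariant.step (hG : IsColumnOrder G) {x : A} {Y Z : List A} {S S' : Finset A}
    (h : CommutatorInvariant G x Y Z S S') {c d : A} (hc : c ∈ S) (hd : d ∈ S') (hcd : ¬ G c d) :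
    CommutatorInvariant G x (c :: Y) (d :: Z) (below G c) (below G d) where
  forall₂ := .cons hcd h.forall₂
  chain := h.chain_left c hc
  paired _ he := ⟨hG.mix_right hcd (mem_below.1 he), h.paired d hd⟩
  subset _ he _ hw := mem_below.2 <|
    hG.mix_left hcd (hG.trans (mem_below.1 hw) (mem_below.1 he))
  chain_left _ he := List.isChain_cons_cons.2 ⟨mem_below.1 he, h.chain_left c hc⟩
  chain_right _ he := List.isChain_cons_cons.2 ⟨mem_below.1 he, h.chain_right d hd⟩

theorem columnCommutator_zero (hG : IsColumnOrder G) (hu : KnuthRelations G u) {x : A}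
    {Y Z : List A} {S S' : Finset A} (h : CommutatorInvariant G x Y Z S S') (p : ℕ) :
    columnCommutator G u x Y Z S S' p 0 = 0 := by
  have := wordProd_mul_comm_of_forall₂ hG hu h.chain h.forall₂
  simp only [columnCommutator, columnSum_zero, one_mul, mul_assoc, mul_sub]
  rw [this, sub_self]

/-- The commutator of `u x` with two words. -/
def wordCommutator (u : A → Q) (x : A) (Y Z : List A) : Q :=
  wordProd u (Y ++ [x]) * wordProd u Z - wordProd u Y * wordProd u Z * u x

/-- The part of the right column below `d` moves to the front, past both `Y` and `Y ++ [x]`, and so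
leaves a commutator of fixed words. -/
theorem CommutatorInvariant.mul_eq (hG : IsColumnOrder G) (hu : KnuthRelations G u) {x : A}
    {Y Z : List A} {S S' : Finset A} (h : CommutatorInvariant G x Y Z S S') {d : A} (hd : d ∈ S')
    (q : ℕ) :
    wordProd u Y * (u x * (columnSum G u q (below G d) * u d * wordProd u Z) -
      columnSum G u q (below G d) * u d * wordProd u Z * u x) =
    columnSum G u q (below G d) * wordCommutator u x Y (d :: Z) := by
  have hS : ∀ w ∈ below G d, (w :: d :: Z).IsChain G := fun w hw =>
    List.isChain_cons_cons.2 ⟨mem_below.1 hw, h.chain_right d hd⟩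
  have h1 := wordProd_mul_columnSum hG hu q (h.paired d hd) hS
  have h2 := wordProd_mul_columnSum hG hu q (h.paired d hd).of_append hS
  rw [wordCommutator, mul_sub, mul_sub, ← mul_assoc (columnSum G u q _), ← h1,
    ← mul_assoc (columnSum G u q _), ← mul_assoc (columnSum G u q _), ← h2]
  simp only [wordProd_append, wordProd_cons, wordProd_nil, mul_one, mul_assoc]

theorem columnCommutator_succ_right {x : A} {Y Z : List A} {S S' : Finset A} (p q : ℕ) :
    columnCommutator G u x Y Z S S' p (q + 1) =
      ∑ d ∈ S', columnSum G u p S * (wordProd u Y *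
        (u x * (columnSum G u q (below G d) * u d * wordProd u Z) -
          columnSum G u q (below G d) * u d * wordProd u Z * u x)) := by
  rw [columnCommutator, columnSum_succ]
  simp only [Finset.mul_sum, Finset.sum_mul, ← Finset.sum_sub_distrib, mul_assoc]

theorem columnCommutator_zero_succ (hG : IsColumnOrder G) (hu : KnuthRelations G u) {x : A}
    {Y Z : List A} {S S' : Finset A} (h : CommutatorInvariant G x Y Z S S') (q : ℕ) :
    columnCommutator G u x Y Z S S' 0 (q + 1) =
      ∑ d ∈ S', columnSum G u q (below G d) * wordCommutator u x Y (d :: Z) := by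
  rw [columnCommutator_succ_right]
  refine Finset.sum_congr rfl fun d hd => ?_
  rw [columnSum_zero, one_mul, h.mul_eq hG hu hd]

/-- For the next entry `d` on the right, the left columns split according to whether their next
entry `c` satisfies `G c d`. If it does, both remaining columns range over `below G d` and the
expansion stops; otherwise `c` and `d` form one more admissible row. -/
theorem columnCommutator_succ_succ (hG : IsColumnOrder G) (hu : KnuthRelations G u) {x : A}
    {Y Z : List A} {S S' : Finset A} (h : CommutatorInvariant G x Y Z S S') (p q : ℕ) :
    columnCommutator G u x Y Z S S' (p + 1) (q + 1) =
      ∑ d ∈ S', columnSum G u (p + 1) (below G d) * columnSum G u q (below G d) *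
        wordCommutator u x Y (d :: Z) +
      ∑ d ∈ S', ∑ c ∈ S with ¬ G c d,
        columnCommutator G u x (c :: Y) (d :: Z) (below G c) (below G d) p q := by
  rw [columnCommutator_succ_right, ← Finset.sum_add_distrib]
  refine Finset.sum_congr rfl fun d hd => ?_
  rw [columnSum_succ_split (h.subset d hd), add_mul, h.mul_eq hG hu hd, ← mul_assoc,
    ← h.mul_eq hG hu hd, Finset.sum_mul]
  congr 1
  refine Finset.sum_congr rfl fun c _ => ?_
  simp only [columnCommutator, wordProd_cons, mul_assoc]

/-- The row by row expansion reduces the symmetry in `p` and `q` to commutation of column sums over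
the sets `below G d`. In the boundary cases the recursive terms vanish by `columnCommutator_zero`.
-/
theorem columnCommutator_comm (hG : IsColumnOrder G) (hu : KnuthRelations G u) {x : A}
    {Y Z : List A} {S S' : Finset A} (h : CommutatorInvariant G x Y Z S S')
    (hS' : ∀ d ∈ S', below G d ⊆ S')
    (hc : ∀ d ∈ S', ∀ p q, Commute (columnSum G u p (below G d)) (columnSum G u q (below G d)))
    (p q : ℕ) :
    columnCommutator G u x Y Z S S' p (q + 1) = columnCommutator G u x Y Z S S' q (p + 1) := by
  induction p generalizing q Y Z S S' with
  | zero =>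
    cases q with
    | zero => rfl
    | succ q =>
      rw [columnCommutator_zero_succ hG hu h, columnCommutator_succ_succ hG hu h]
      rw [Finset.sum_eq_zero (s := S') (f := fun d => ∑ c ∈ S with ¬ G c d, _), add_zero]
      · simp
      · intro d hd
        refine Finset.sum_eq_zero fun c hc => ?_
        rw [Finset.mem_filter] at hc
        exact columnCommutator_zero hG hu (h.step hG hc.1 hd hc.2) _
  | succ p ih =>
    cases q with
    | zero =>
      rw [columnCommutator_zero_succ hG hu h, columnCommutator_succ_succ hG hu h]
      rw [Finset.sum_eq_zero (s := S') (f := fun d => ∑ c ∈ S with ¬ G c d, _), add_zero]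
      · simp
      · intro d hd
        refine Finset.sum_eq_zero fun c hc => ?_
        rw [Finset.mem_filter] at hc
        exact columnCommutator_zero hG hu (h.step hG hc.1 hd hc.2) _
    | succ q =>
      rw [columnCommutator_succ_succ hG hu h, columnCommutator_succ_succ hG hu h]
      congr 1
      · refine Finset.sum_congr rfl fun d hd => ?_
        rw [(hc d hd _ _).eq]
      · refine Finset.sum_congr rfl fun d hd => Finset.sum_congr rfl fun c hcS => ?_
        rw [Finset.mem_filter] at hcS
        exact ih (h.step hG hcS.1 hd hcS.2)
          (fun e he w hw => mem_below.2 (hG.trans (mem_below.1 hw) (mem_below.1 he)))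
          (fun e he => hc e (hS' d hd he)) q

omit [Fintype A] [DecidableRel G] in
theorem exists_top (hG : IsColumnOrder G) {S : Finset A} (hS : S.Nonempty) :
    ∃ x ∈ S, ∀ y ∈ S, y ≠ x → G y x := by
  classical
  induction hS using Finset.Nonempty.cons_induction with
  | singleton a => exact ⟨a, by simp, by simp⟩
  | cons a s ha hs ih =>
    obtain ⟨x, hx, h⟩ := ih
    have hne : x ≠ a := fun e => ha (e ▸ hx)
    rcases hG.connected hne with hxa | hax
    · refine ⟨a, by simp, fun y hy hya => ?_⟩
      rcases Finset.mem_cons.1 hy with rfl | hy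
      · exact (hya rfl).elim
      · by_cases hyx : y = x
        · exact hyx ▸ hxa
        · exact hG.trans (h y hy hyx) hxa
    · refine ⟨x, by simp [hx], fun y hy hyx => ?_⟩
      rcases Finset.mem_cons.1 hy with rfl | hy
      · exact hax
      · exact h y hy hyx

/-- Induction on the size of `S`: the letter `x` that can stand on top of all others is removed. The
only terms not controlled by smaller sets are commutators of `u x` with column sums over the
remaining letters, and `columnCommutator_comm` handles these. -/
theorem columnSum_commute (hG : IsColumnOrder G) (hu : KnuthRelations G u) (S : Finset A)
    (hS : ∀ d ∈ S, below G d ⊆ S) (p q : ℕ) :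
    Commute (columnSum G u p S) (columnSum G u q S) := by
  classical
  induction hn : S.card using Nat.strong_induction_on generalizing S p q with
  | _ n ihn =>
  subst hn
  rcases S.eq_empty_or_nonempty with rfl | hne
  · cases p with
    | zero => exact Commute.one_left _
    | succ p => simp [columnSum_succ]
  obtain ⟨x, hx, hmin⟩ := exists_top hG hne
  have hB : ∀ d ∈ S.erase x, below G d ⊆ S.erase x := fun d hd w hw => by
    rw [Finset.mem_erase] at hd ⊢
    refine ⟨?_, hS d hd.2 hw⟩
    rintro rfl
    exact hd.1 (hG.antisymm (hmin d hd.2 hd.1) (mem_below.1 hw))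
  have hcard : (S.erase x).card < S.card := Finset.card_erase_lt_of_mem hx
  have hBcomm : ∀ p q, Commute (columnSum G u p (S.erase x)) (columnSum G u q (S.erase x)) :=
    fun p q => ihn _ hcard _ hB p q rfl
  have hdcomm : ∀ d ∈ S.erase x, ∀ p q,
      Commute (columnSum G u p (below G d)) (columnSum G u q (below G d)) := fun d hd p q =>
    ihn _ ((Finset.card_le_card (hB d hd)).trans_lt hcard) _
      (fun e he w hw => mem_below.2 (hG.trans (mem_below.1 hw) (mem_below.1 he))) p q rfl
  have hlt : ∀ d ∈ S.erase x, ¬ G x d := fun d hd h => by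
    rw [Finset.mem_erase] at hd
    exact hd.1 (hG.antisymm (hmin d hd.2 hd.1) h)
  have hinv : CommutatorInvariant G x [] [] (below G x) (S.erase x) :=
    { forall₂ := .nil
      chain := by simp
      paired := fun d hd => ⟨hlt d hd, trivial⟩
      subset := fun d hd w hw => by
        rw [Finset.mem_erase] at hd
        exact mem_below.2 (hG.trans (mem_below.1 hw) (hmin d hd.2 hd.1))
      chain_left := fun c hc => by simpa using hc
      chain_right := fun d hd => by simp }
  have hcc : ∀ p q, columnSum G u p (below G x) *
      (u x * columnSum G u (q + 1) (S.erase x) - columnSum G u (q + 1) (S.erase x) * u x) =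
      columnSum G u q (below G x) *
      (u x * columnSum G u (p + 1) (S.erase x) - columnSum G u (p + 1) (S.erase x) * u x) := by
    intro p q
    have := columnCommutator_comm hG hu hinv hB hdcomm p q
    simpa [columnCommutator] using this
  have hsplit : ∀ k, columnSum G u (k + 1) S =
      columnSum G u (k + 1) (S.erase x) + columnSum G u k (below G x) * u x := fun k => by
    rw [columnSum_succ, columnSum_succ, Finset.sum_erase_add _ _ hx]
  -- If `x` may be repeated in a column, the letters allowed below it are all of `S`; otherwise they
  -- are `S.erase x`.
  by_cases hxx : G x x
  · have hSx : below G x = S := by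
      refine Finset.Subset.antisymm (hS x hx) fun y hy => mem_below.2 ?_
      by_cases h : y = x
      · exact h ▸ hxx
      · exact hmin y hy h
    rw [hSx] at hcc hsplit
    -- The set does not shrink under a repeatable `x`, so a second induction, on the total degree,
    -- is needed.
    induction hm : p + q using Nat.strong_induction_on generalizing p q with
    | _ m ihm =>
    subst hm
    cases p with
    | zero => exact Commute.one_left _
    | succ p =>
    cases q with
    | zero => exact Commute.one_right _
    | succ q =>
    have h1 := (ihm (p + q) (by omega) p q rfl).eq
    have h2 := (ihm (p + (q + 1)) (by omega) p (q + 1) rfl).eq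
    have h3 := (ihm ((p + 1) + q) (by omega) (p + 1) q rfl).eq
    have h4 := (hBcomm (p + 1) (q + 1)).eq
    have h5 := hcc p q
    have ha := hsplit p
    have hb := hsplit q
    rw [commute_iff_eq]
    generalize columnSum G u (p + 1) S = a at *
    generalize columnSum G u (q + 1) S = b at *
    generalize columnSum G u p S = a' at *
    generalize columnSum G u q S = b' at *
    generalize columnSum G u (p + 1) (S.erase x) = α at *
    generalize columnSum G u (q + 1) (S.erase x) = β at *
    generalize u x = t at *
    obtain rfl : α = a - a' * t := by rw [ha]; abel
    obtain rfl : β = b - b' * t := by rw [hb]; abel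
    clear ha hb
    -- `h5` cancels the terms of `h4` in which `t` stands between two column sums; the other terms
    -- are commutators of smaller total degree.
    linear_combination (norm := noncomm_ring) h4 + h5 + h2 * t + h3 * t - h1 * t * t
  · have hSx : below G x = S.erase x := by
      ext y
      rw [mem_below, Finset.mem_erase]
      refine ⟨fun h => ⟨?_, hS x hx (mem_below.2 h)⟩, fun h => hmin y h.2 h.1⟩
      rintro rfl
      exact hxx h
    rw [hSx] at hcc hsplit
    cases p with
    | zero => exact Commute.one_left _
    | succ p =>
    cases q with
    | zero => exact Commute.one_right _
    | succ q =>
    -- Since `¬ G x x`, the letter `x` may be repeated in a row, so one copy moves past a column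
    -- standing on the other.
    have hquad : ∀ k, u x * columnSum G u k (S.erase x) * u x =
        columnSum G u k (S.erase x) * u x * u x := fun k => by
      have := wordProd_mul_columnSum hG hu (Y := [x]) (Z := [x]) k (S := S.erase x)
        ⟨hxx, trivial⟩ (fun w hw => by
          rw [Finset.mem_erase] at hw
          simpa using hmin w hw.2 hw.1)
      simpa using this
    have h1 := (hBcomm p q).eq
    have h2 := (hBcomm p (q + 1)).eq
    have h3 := (hBcomm (p + 1) q).eq
    have h4 := (hBcomm (p + 1) (q + 1)).eq
    have h5 := hcc p q
    have h6 := hquad p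
    have h7 := hquad q
    rw [commute_iff_eq, hsplit, hsplit]
    generalize columnSum G u (p + 1) (S.erase x) = a at *
    generalize columnSum G u (q + 1) (S.erase x) = b at *
    generalize columnSum G u p (S.erase x) = a' at *
    generalize columnSum G u q (S.erase x) = b' at *
    generalize u x = t at *
    linear_combination (norm := noncomm_ring)
      h4 + h5 + h2 * t + h3 * t + a' * h7 - b' * h6 + h1 * t * t

end Elementary
-- Pairs of adjacent columns and their first row failure.
section Columns

variable {A Q : Type*} [Fintype A] [Ring Q] {G : A → A → Prop} [DecidableRel G] {u : A → Q}

/-- The sum of `F C` over all columns `C` (listed from top to bottom) of length `k` whose top entry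
is in `S`. -/
def sumColumns (G : A → A → Prop) [DecidableRel G] :
    ℕ → Finset A → (List A → Q) → Q
  | 0, _, F => F []
  | k + 1, S, F => ∑ x ∈ S, sumColumns G k (below G x) fun C => F (x :: C)

@[simp] theorem sumColumns_zero (S : Finset A) (F : List A → Q) :
    sumColumns G 0 S F = F [] := rfl

theorem sumColumns_succ (k : ℕ) (S : Finset A) (F : List A → Q) :
    sumColumns G (k + 1) S F = ∑ x ∈ S, sumColumns G k (below G x) fun C => F (x :: C) := rfl

theorem sumColumns_sum {ι : Type*} (k : ℕ) (S : Finset A) (s : Finset ι)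
    (F : ι → List A → Q) :
    sumColumns G k S (fun C => ∑ i ∈ s, F i C) = ∑ i ∈ s, sumColumns G k S (F i) := by
  induction k generalizing S F with
  | zero => rfl
  | succ k ih =>
    simp only [sumColumns_succ, ih]
    exact Finset.sum_comm

@[simp] theorem sumColumns_const_zero (k : ℕ) (S : Finset A) :
    sumColumns G k S (fun _ => (0 : Q)) = 0 := by
  simpa using sumColumns_sum (G := G) (Q := Q) k S (∅ : Finset ℕ) fun _ _ => 0

theorem sumColumns_mul_right (k : ℕ) (S : Finset A) (F : List A → Q) (a : Q) :
    sumColumns G k S (fun C => F C * a) = sumColumns G k S F * a := by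
  induction k generalizing S F with
  | zero => rfl
  | succ k ih => simp only [sumColumns_succ, ih, Finset.sum_mul]

theorem sumColumns_mul_left (k : ℕ) (S : Finset A) (F : List A → Q) (a : Q) :
    sumColumns G k S (fun C => a * F C) = a * sumColumns G k S F := by
  induction k generalizing S F with
  | zero => rfl
  | succ k ih => simp only [sumColumns_succ, ih, Finset.mul_sum]

theorem sumColumns_congr {k : ℕ} {S : Finset A} {F F' : List A → Q}
    (h : ∀ C : List A, C.length = k → F C = F' C) :
    sumColumns G k S F = sumColumns G k S F' := by
  induction k generalizing S F F' with
  | zero => exact h [] rfl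
  | succ k ih =>
    simp only [sumColumns_succ]
    exact Finset.sum_congr rfl fun x _ => ih fun C hC => h _ (by simp [hC])

/-- The reading word of a column (listed from top to bottom), as a product of variables. -/
def columnProd (u : A → Q) : List A → Q
  | [] => 1
  | c :: C => columnProd u C * u c

omit [Fintype A] in
@[simp] theorem columnProd_nil : columnProd u [] = 1 := rfl

omit [Fintype A] in
@[simp] theorem columnProd_cons (c : A) (C : List A) :
    columnProd u (c :: C) = columnProd u C * u c := rfl

omit [Fintype A] in
theorem columnProd_eq (C : List A) : columnProd u C = wordProd u C.reverse := by
  induction C with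
  | nil => simp
  | cons c C ih => simp [ih]

theorem sumColumns_columnProd (k : ℕ) (S : Finset A) :
    sumColumns G k S (columnProd u) = columnSum G u k S := by
  induction k generalizing S with
  | zero => rfl
  | succ k ih =>
    simp only [sumColumns_succ, columnProd_cons, sumColumns_mul_right, ih, columnSum_succ]

-- The empty column satisfies the head condition vacuously, which agrees with the value 1 of a
-- column sum of length zero.
open Classical in
theorem sumColumns_head {S : Finset A} {d : A} (hS : below G d ⊆ S) (k : ℕ) (F : List A → Q) :
    sumColumns G k S (fun C => if ∀ c ∈ C.head?, G c d then F C else 0) =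
      sumColumns G k (below G d) F := by
  cases k with
  | zero => simp
  | succ k =>
    simp only [sumColumns_succ, List.head?_cons, Option.mem_some_iff, forall_eq']
    rw [← Finset.sum_subset hS]
    · refine Finset.sum_congr rfl fun c hc => ?_
      simp [mem_below.1 hc]
    · intro c _ hc
      simp [mt mem_below.2 hc]

/-- Placing the column `D` to the right of the column `C`, the row condition fails in row `r`. -/
def FailsAt (G : A → A → Prop) (r : ℕ) (C D : List A) : Prop :=
  ∃ d ∈ D[r]?, ∀ c ∈ C[r]?, G c d

/-- The row condition for `C` and `D` fails in row `r`, but not above. -/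
def FirstFailsAt (G : A → A → Prop) (r : ℕ) (C D : List A) : Prop :=
  FailsAt G r C D ∧ ∀ s < r, ¬ FailsAt G s C D

section
omit [Fintype A] [DecidableRel G]

@[simp] theorem not_failsAt_nil (r : ℕ) (C : List A) : ¬ FailsAt G r C [] := by
  simp [FailsAt]

theorem failsAt_zero_cons (C : List A) (d : A) (D : List A) :
    FailsAt G 0 C (d :: D) ↔ ∀ c ∈ C.head?, G c d := by
  simp [FailsAt, List.head?_eq_getElem?]

theorem failsAt_succ_cons (r : ℕ) (c : A) (C : List A) (d : A) (D : List A) :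
    FailsAt G (r + 1) (c :: C) (d :: D) ↔ FailsAt G r C D := by
  simp [FailsAt]

@[simp] theorem not_firstFailsAt_nil (r : ℕ) (C : List A) : ¬ FirstFailsAt G r C [] :=
  fun h => not_failsAt_nil _ _ h.1

theorem firstFailsAt_zero_cons (C : List A) (d : A) (D : List A) :
    FirstFailsAt G 0 C (d :: D) ↔ ∀ c ∈ C.head?, G c d := by
  simp [FirstFailsAt, failsAt_zero_cons]

theorem not_firstFailsAt_succ_nil (r : ℕ) (D : List A) : ¬ FirstFailsAt G (r + 1) [] D := by
  cases D with
  | nil => exact not_firstFailsAt_nil _ _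
  | cons d D => exact fun h => h.2 0 (Nat.succ_pos r) ((failsAt_zero_cons _ _ _).2 (by simp))

theorem firstFailsAt_succ_cons (r : ℕ) (c : A) (C : List A) (d : A) (D : List A) :
    FirstFailsAt G (r + 1) (c :: C) (d :: D) ↔ ¬ G c d ∧ FirstFailsAt G r C D := by
  have h0 : FailsAt G 0 (c :: C) (d :: D) ↔ G c d := by simp [failsAt_zero_cons]
  simp only [FirstFailsAt, failsAt_succ_cons, Nat.forall_lt_succ_left, h0]
  tauto

end

open Classical in
/-- The sum over pairs of columns (below fixed words `Y` and `Z`) that first fail in row `r`,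
with a condition `K` on their top parts. -/
noncomputable def failingSum (G : A → A → Prop) [DecidableRel G] (u : A → Q) (r : ℕ)
    (K : List A → List A → Prop) (Y Z : List A) (S S' : Finset A) (a b : ℕ) : Q :=
  sumColumns G a S fun C => sumColumns G b S' fun D =>
    if FirstFailsAt G r C D ∧ K (C.take r) (D.take (r + 1)) then
      columnProd u C * wordProd u Y * (columnProd u D * wordProd u Z) else 0

theorem failingSum_right_zero (r : ℕ) (K : List A → List A → Prop) (Y Z : List A)
    (S S' : Finset A) (a : ℕ) : failingSum G u r K Y Z S S' a 0 = 0 := by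
  simp [failingSum]

theorem failingSum_left_zero (r : ℕ) (K : List A → List A → Prop) (Y Z : List A)
    (S S' : Finset A) (b : ℕ) : failingSum G u (r + 1) K Y Z S S' 0 b = 0 := by
  simp [failingSum, not_firstFailsAt_succ_nil]

-- A failure at `d` forces the rest of the left column into `below G d`, where the rest of the right
-- column already lies. The latter's sum then passes `Y`, so the two sums stand side by side.
open Classical in
theorem failingSum_zero_succ (hG : IsColumnOrder G) (hu : KnuthRelations G u)
    {K : List A → List A → Prop} {Y Z : List A} {S S' : Finset A}
    (hp : ∀ d ∈ S', RowPaired G Y (d :: Z)) (hS : ∀ d ∈ S', below G d ⊆ S)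
    (hZ : ∀ d ∈ S', (d :: Z).IsChain G) (a b : ℕ) :
    failingSum G u 0 K Y Z S S' a (b + 1) = ∑ d ∈ S', if K [] [d] then
      columnSum G u a (below G d) * columnSum G u b (below G d) *
        (wordProd u Y * wordProd u (d :: Z)) else 0 := by
  simp only [failingSum, sumColumns_succ, sumColumns_sum, firstFailsAt_zero_cons]
  refine Finset.sum_congr rfl fun d hd => ?_
  by_cases hK : K [] [d]
  · have h1 : ∀ C : List A, (sumColumns G b (below G d) fun D =>
        if (∀ c ∈ C.head?, G c d) ∧ K (C.take 0) ((d :: D).take (0 + 1)) then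
          columnProd u C * wordProd u Y * (columnProd u (d :: D) * wordProd u Z) else 0) =
        if ∀ c ∈ C.head?, G c d then columnProd u C * (wordProd u Y *
          (columnSum G u b (below G d) * wordProd u (d :: Z))) else 0 := by
      intro C
      by_cases hC : ∀ c ∈ C.head?, G c d
      · simp only [eq_true hC, List.take_zero, List.take_succ_cons, hK, and_self, if_true,
          columnProd_cons, wordProd_cons, ← sumColumns_columnProd (u := u), mul_assoc,
          sumColumns_mul_left, sumColumns_mul_right]
      · simp only [eq_false hC, false_and, if_false, sumColumns_const_zero]
    simp only [h1, if_pos hK]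
    rw [sumColumns_head (hS d hd), sumColumns_mul_right, sumColumns_columnProd, mul_assoc,
      ← mul_assoc (wordProd u Y), wordProd_mul_columnSum hG hu b (hp d hd), mul_assoc]
    exact fun w hw => List.isChain_cons_cons.2 ⟨mem_below.1 hw, hZ d hd⟩
  · simp [hK]

open Classical in
theorem failingSum_succ_succ (r : ℕ) (K : List A → List A → Prop) (Y Z : List A)
    (S S' : Finset A) (a b : ℕ) :
    failingSum G u (r + 1) K Y Z S S' (a + 1) (b + 1) =
      ∑ d ∈ S', ∑ c ∈ S with ¬ G c d, failingSum G u r (fun C D => K (c :: C) (d :: D))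
        (c :: Y) (d :: Z) (below G c) (below G d) a b := by
  simp only [failingSum, sumColumns_succ, sumColumns_sum, firstFailsAt_succ_cons, Finset.sum_filter]
  rw [Finset.sum_comm]
  refine Finset.sum_congr rfl fun d _ => Finset.sum_congr rfl fun c _ => ?_
  by_cases h : G c d
  · simp [h]
  · simp [h, mul_assoc]

/-- Rows above the failure are peeled off into `Y` and `Z`; an admissible row preserves the diagonal
pairing needed at the end. At the failing row the claim is commutation of two column sums over
`below G d`. -/
theorem failingSum_comm (hG : IsColumnOrder G) (hu : KnuthRelations G u) (r : ℕ)
    {K : List A → List A → Prop} {Y Z : List A} {S S' : Finset A}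
    (hp : ∀ d ∈ S', RowPaired G Y (d :: Z)) (hS : ∀ d ∈ S', below G d ⊆ S)
    (hZ : ∀ d ∈ S', (d :: Z).IsChain G) (a b : ℕ) :
    failingSum G u r K Y Z S S' a (b + 1) = failingSum G u r K Y Z S S' b (a + 1) := by
  induction r generalizing K Y Z S S' a b with
  | zero =>
    rw [failingSum_zero_succ hG hu hp hS hZ, failingSum_zero_succ hG hu hp hS hZ]
    refine Finset.sum_congr rfl fun d _ => ?_
    rw [(columnSum_commute hG hu (below G d) (fun e he w hw =>
      mem_below.2 (hG.trans (mem_below.1 hw) (mem_below.1 he))) a b).eq]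
  | succ r ih =>
    -- A right column of one letter has no row `r + 1` in which to fail.
    have h0 : ∀ b, failingSum G u (r + 1) K Y Z S S' b 1 = 0 := fun b => by
      cases b with
      | zero => exact failingSum_left_zero _ _ _ _ _ _ _
      | succ b =>
        rw [failingSum_succ_succ]
        simp [failingSum_right_zero]
    rcases a with _ | a
    · rw [failingSum_left_zero, h0]
    rcases b with _ | b
    · rw [failingSum_left_zero, h0]
    rw [failingSum_succ_succ, failingSum_succ_succ]
    refine Finset.sum_congr rfl fun d hd => Finset.sum_congr rfl fun c hc => ?_
    rw [Finset.mem_filter] at hc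
    refine ih (Y := c :: Y) (Z := d :: Z) (fun e he => And.intro (hG.mix_right hc.2 (mem_below.1 he)) (hp d hd))
      (fun e he w hw => mem_below.2 <|
        hG.mix_left hc.2 (hG.trans (mem_below.1 hw) (mem_below.1 he)))
      (fun e he => List.isChain_cons_cons.2 ⟨mem_below.1 he, hZ d hd⟩) a b

/-- The sum of `F C` over all columns `C` of length `k`, which is `0` if `k` is negative. -/
def sumColumnsInt (G : A → A → Prop) [DecidableRel G] : ℤ → (List A → Q) → Q
  | Int.ofNat k, F => sumColumns G k Finset.univ F
  | Int.negSucc _, _ => 0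

@[simp] theorem sumColumnsInt_natCast (k : ℕ) (F : List A → Q) :
    sumColumnsInt G (k : ℤ) F = sumColumns G k Finset.univ F := rfl

theorem sumColumnsInt_of_neg {k : ℤ} (hk : k < 0) (F : List A → Q) :
    sumColumnsInt G k F = 0 := by
  obtain ⟨n, rfl⟩ := Int.eq_negSucc_of_lt_zero hk
  rfl

theorem sumColumnsInt_sum {ι : Type*} (k : ℤ) (s : Finset ι) (F : ι → List A → Q) :
    sumColumnsInt G k (fun C => ∑ i ∈ s, F i C) = ∑ i ∈ s, sumColumnsInt G k (F i) := by
  cases k with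
  | ofNat k => exact sumColumns_sum _ _ _ _
  | negSucc k => simp [sumColumnsInt]

@[simp] theorem sumColumnsInt_const_zero (k : ℤ) :
    sumColumnsInt G k (fun _ => (0 : Q)) = 0 := by
  cases k with
  | ofNat k => exact sumColumns_const_zero _ _
  | negSucc k => rfl

theorem sumColumnsInt_mul_right (k : ℤ) (F : List A → Q) (a : Q) :
    sumColumnsInt G k (fun C => F C * a) = sumColumnsInt G k F * a := by
  cases k with
  | ofNat k => exact sumColumns_mul_right _ _ _ _
  | negSucc k => simp [sumColumnsInt]

theorem sumColumnsInt_mul_left (k : ℤ) (F : List A → Q) (a : Q) :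
    sumColumnsInt G k (fun C => a * F C) = a * sumColumnsInt G k F := by
  cases k with
  | ofNat k => exact sumColumns_mul_left _ _ _ _
  | negSucc k => simp [sumColumnsInt]

theorem sumColumnsInt_congr {k : ℤ} {F F' : List A → Q}
    (h : ∀ C : List A, (C.length : ℤ) = k → F C = F' C) :
    sumColumnsInt G k F = sumColumnsInt G k F' := by
  cases k with
  | ofNat k => exact sumColumns_congr fun C hC => h C (by simp [hC])
  | negSucc k => rfl

open Classical in
theorem sumColumnsInt_firstFailsAt_comm (hG : IsColumnOrder G) (hu : KnuthRelations G u) (r : ℕ)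
    (K : List A → List A → Prop) (a b : ℤ) :
    (sumColumnsInt G a fun C => sumColumnsInt G b fun D =>
      if FirstFailsAt G r C D ∧ K (C.take r) (D.take (r + 1)) then
        columnProd u C * columnProd u D else 0) =
    sumColumnsInt G (b - 1) fun C => sumColumnsInt G (a + 1) fun D =>
      if FirstFailsAt G r C D ∧ K (C.take r) (D.take (r + 1)) then
        columnProd u C * columnProd u D else 0 := by
  -- A negative length gives 0 and an empty right column cannot fail. This degenerate range is
  -- stable under the exchange of lengths.
  have h0 : ∀ (a b : ℤ), a < 0 ∨ b ≤ 0 → (sumColumnsInt G a fun C => sumColumnsInt G b fun D =>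
      if FirstFailsAt G r C D ∧ K (C.take r) (D.take (r + 1)) then
        columnProd u C * columnProd u D else 0) = 0 := by
    rintro a b (h | h)
    · exact sumColumnsInt_of_neg h _
    · rcases h.lt_or_eq with h | rfl
      · simp [sumColumnsInt_of_neg h]
      · have : ∀ F : List A → Q, sumColumnsInt G 0 F = F [] := fun F => rfl
        simp [this]
  by_cases h : a < 0 ∨ b ≤ 0
  · rw [h0 a b h, h0 (b - 1) (a + 1) (by omega)]
  · obtain ⟨m, rfl⟩ := Int.eq_ofNat_of_zero_le (show 0 ≤ a by omega)
    obtain ⟨n, rfl⟩ : ∃ n : ℕ, b = (n + 1 : ℕ) := ⟨(b - 1).toNat, by omega⟩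
    have := failingSum_comm hG hu r (K := K) (Y := []) (Z := []) (S := Finset.univ)
      (S' := Finset.univ) (fun _ _ => trivial) (fun _ _ => Finset.subset_univ _) (by simp) m n
    have e1 : (((n + 1 : ℕ) : ℤ) - 1) = (n : ℤ) := by push_cast; ring
    have e2 : ((m : ℤ) + 1) = ((m + 1 : ℕ) : ℤ) := by push_cast; ring
    rw [e1, e2]
    simpa only [failingSum, sumColumnsInt_natCast, wordProd_nil, mul_one] using this

end Columns
-- Tuples of columns and the sign-reversing cancellation.
section Tuples

variable {A Q : Type*} [Fintype A] [Ring Q] {G : A → A → Prop} [DecidableRel G] {u : A → Q}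

/-- The sum of `F` over all lists of columns with the given lengths. -/
def sumTuples (G : A → A → Prop) [DecidableRel G] : List ℤ → (List (List A) → Q) → Q
  | [], F => F []
  | a :: L, F => sumColumnsInt G a fun C => sumTuples G L fun Cs => F (C :: Cs)

@[simp] theorem sumTuples_nil (F : List (List A) → Q) : sumTuples G [] F = F [] := rfl

theorem sumTuples_cons (a : ℤ) (L : List ℤ) (F : List (List A) → Q) :
    sumTuples G (a :: L) F =
      sumColumnsInt G a fun C => sumTuples G L fun Cs => F (C :: Cs) := rfl

theorem sumTuples_append (L L' : List ℤ) (F : List (List A) → Q) :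
    sumTuples G (L ++ L') F =
      sumTuples G L fun Cs => sumTuples G L' fun Cs' => F (Cs ++ Cs') := by
  induction L generalizing F with
  | nil => rfl
  | cons a L ih => simp [sumTuples_cons, ih]

theorem sumTuples_sum {ι : Type*} (L : List ℤ) (s : Finset ι) (F : ι → List (List A) → Q) :
    sumTuples G L (fun Cs => ∑ i ∈ s, F i Cs) = ∑ i ∈ s, sumTuples G L (F i) := by
  induction L generalizing F with
  | nil => rfl
  | cons a L ih => simp only [sumTuples_cons, ih, sumColumnsInt_sum]

theorem sumTuples_add (L : List ℤ) (F F' : List (List A) → Q) :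
    sumTuples G L (fun Cs => F Cs + F' Cs) = sumTuples G L F + sumTuples G L F' := by
  simpa using sumTuples_sum (G := G) L Finset.univ fun i : Fin 2 => ![F, F'] i

@[simp] theorem sumTuples_const_zero (L : List ℤ) :
    sumTuples G L (fun _ => (0 : Q)) = 0 := by
  simpa using sumTuples_sum (G := G) (Q := Q) L (∅ : Finset ℕ) fun _ _ => 0

theorem sumTuples_mul_left (L : List ℤ) (F : List (List A) → Q) (a : Q) :
    sumTuples G L (fun Cs => a * F Cs) = a * sumTuples G L F := by
  induction L generalizing F with
  | nil => rfl
  | cons b L ih => simp only [sumTuples_cons, ih, sumColumnsInt_mul_left]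

theorem sumTuples_congr {L : List ℤ} {F F' : List (List A) → Q}
    (h : ∀ Cs : List (List A), Cs.map (fun C => (C.length : ℤ)) = L → F Cs = F' Cs) :
    sumTuples G L F = sumTuples G L F' := by
  induction L generalizing F F' with
  | nil => exact h [] rfl
  | cons a L ih =>
    simp only [sumTuples_cons]
    exact sumColumnsInt_congr fun C hC => ih fun Cs hCs => h _ (by simp [hC, hCs])

theorem sumColumns_sumTuples (k : ℕ) (S : Finset A) (L : List ℤ)
    (F : List A → List (List A) → Q) :
    (sumColumns G k S fun C => sumTuples G L (F C)) =
      sumTuples G L fun Cs => sumColumns G k S fun C => F C Cs := by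
  induction k generalizing S F with
  | zero => rfl
  | succ k ih => simp only [sumColumns_succ, ih, sumTuples_sum]

theorem sumColumnsInt_sumTuples (k : ℤ) (L : List ℤ) (F : List A → List (List A) → Q) :
    (sumColumnsInt G k fun C => sumTuples G L (F C)) =
      sumTuples G L fun Cs => sumColumnsInt G k fun C => F C Cs := by
  cases k with
  | ofNat k => exact sumColumns_sumTuples _ _ _ _
  | negSucc k => simp [sumColumnsInt]

/-- The product of the reading words of a list of columns. -/
def tupleProd (u : A → Q) (Cs : List (List A)) : Q := (Cs.map (columnProd u)).prod

omit [Fintype A] in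
theorem tupleProd_cons (C : List A) (Cs : List (List A)) :
    tupleProd u (C :: Cs) = columnProd u C * tupleProd u Cs := by simp [tupleProd]

theorem sumTuples_tupleProd (L : List ℤ) :
    sumTuples G L (tupleProd u) =
      (L.map fun k => sumColumnsInt G k (columnProd u)).prod := by
  induction L with
  | nil => simp [tupleProd]
  | cons a L ih =>
    simp only [sumTuples_cons, tupleProd_cons, List.map_cons, List.prod_cons, sumTuples_mul_left, ih,
      sumColumnsInt_mul_right]

/-- The entry in column `j` and row `s` of a list of columns. -/
def tupleEntry (Cs : List (List A)) (j s : ℕ) : Option A := Cs[j]?.bind fun C => C[s]?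

/-- The row condition fails in row `s` between the columns `j` and `j + 1`. -/
def TupleFailsAt (G : A → A → Prop) (Cs : List (List A)) (s j : ℕ) : Prop :=
  ∃ d ∈ tupleEntry Cs (j + 1) s, ∀ c ∈ tupleEntry Cs j s, G c d

/-- The row condition holds everywhere. -/
def IsTableauTuple (G : A → A → Prop) (Cs : List (List A)) : Prop :=
  ∀ s j, ¬ TupleFailsAt G Cs s j

/-- Row `r` is the topmost row where the row condition fails, and `j` is the rightmost column where
it fails in this row. -/
def SelectedAt (G : A → A → Prop) (r j : ℕ) (Cs : List (List A)) : Prop :=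
  TupleFailsAt G Cs r j ∧ (∀ s < r, ∀ i, ¬ TupleFailsAt G Cs s i) ∧
    ∀ i, j < i → ¬ TupleFailsAt G Cs r i

section
omit [Fintype A] [DecidableRel G]

theorem TupleFailsAt.bound {Cs : List (List A)} {s j : ℕ} (h : TupleFailsAt G Cs s j) :
    j + 1 < Cs.length ∧ ∃ C ∈ Cs, s < C.length := by
  obtain ⟨d, hd, -⟩ := h
  rw [tupleEntry, Option.mem_def, Option.bind_eq_some_iff] at hd
  obtain ⟨C, hC, hd⟩ := hd
  exact ⟨(List.getElem?_eq_some_iff.1 hC).1, C, List.mem_of_getElem? hC,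
    (List.getElem?_eq_some_iff.1 hd).1⟩

theorem SelectedAt.unique {Cs : List (List A)} {r r' j j' : ℕ} (h : SelectedAt G r j Cs)
    (h' : SelectedAt G r' j' Cs) : r = r' ∧ j = j' := by
  obtain rfl : r = r' := by
    rcases lt_trichotomy r r' with hr | hr | hr
    · exact (h'.2.1 r hr j h.1).elim
    · exact hr
    · exact (h.2.1 r' hr j' h'.1).elim
  refine ⟨rfl, ?_⟩
  rcases lt_trichotomy j j' with hj | hj | hj
  · exact (h.2.2 j' hj h'.1).elim
  · exact hj
  · exact (h'.2.2 j hj h.1).elim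

theorem exists_selectedAt {Cs : List (List A)} (h : ¬ IsTableauTuple G Cs) :
    ∃ r j, SelectedAt G r j Cs := by
  classical
  simp only [IsTableauTuple, not_forall, not_not] at h
  have hr := Nat.find_spec h
  have hmin := fun s (hs : s < Nat.find h) => Nat.find_min h hs
  generalize Nat.find h = r at hr hmin
  obtain ⟨j₀, hj₀⟩ := hr
  have hb : ∀ j, TupleFailsAt G Cs r j → j ≤ Cs.length := fun j hj => by
    have := hj.bound.1
    omega
  refine ⟨r, Nat.findGreatest (TupleFailsAt G Cs r) Cs.length,
    Nat.findGreatest_spec (hb _ hj₀) hj₀, fun s hs i hi => hmin s hs ⟨i, hi⟩, fun i hi hf => ?_⟩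
  exact hi.not_ge (Nat.le_findGreatest (hb i hf) hf)

open Classical in
theorem sum_selectedAt {Cs : List (List A)} {M t : ℕ} (ht : Cs.length ≤ t)
    (hM : ∀ C ∈ Cs, C.length ≤ M) (X : Q) :
    X = (if IsTableauTuple G Cs then X else 0) +
      ∑ r ∈ Finset.range M, ∑ j ∈ Finset.range t, if SelectedAt G r j Cs then X else 0 := by
  by_cases h : IsTableauTuple G Cs
  · have : ∀ r j, ¬ SelectedAt G r j Cs := fun r j hs => h r j hs.1
    simp [h, this]
  · obtain ⟨r, j, hs⟩ := exists_selectedAt h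
    obtain ⟨hj, C, hC, hr⟩ := hs.1.bound
    rw [if_neg h, zero_add, Finset.sum_eq_single r, Finset.sum_eq_single j, if_pos hs]
    · exact fun j' _ hj' => if_neg fun hs' => hj' (hs'.unique hs).2
    · exact fun hj' => (hj' (Finset.mem_range.2 (by omega))).elim
    · exact fun r' _ hr' => Finset.sum_eq_zero fun j' _ =>
        if_neg fun hs' => hr' (hs'.unique hs).1
    · exact fun hr' => (hr' (Finset.mem_range.2 (hr.trans_le (hM C hC)))).elim

theorem tupleEntry_append_left {P T : List (List A)} {j s : ℕ} (hj : j < P.length) :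
    tupleEntry (P ++ T) j s = tupleEntry P j s := by
  simp [tupleEntry, List.getElem?_append_left hj]

theorem tupleEntry_append_right (P T : List (List A)) (j s : ℕ) :
    tupleEntry (P ++ T) (P.length + j) s = tupleEntry T j s := by
  simp [tupleEntry, List.getElem?_append_right]

theorem tupleEntry_cons_zero (C : List A) (T : List (List A)) (s : ℕ) :
    tupleEntry (C :: T) 0 s = C[s]? := by simp [tupleEntry]

theorem tupleEntry_cons_succ (C : List A) (T : List (List A)) (j s : ℕ) :
    tupleEntry (C :: T) (j + 1) s = tupleEntry T j s := by simp [tupleEntry]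

theorem tupleEntry_congr {P T : List (List A)} {C C' D D' : List A} {j s : ℕ}
    (hC : j = P.length → C[s]? = C'[s]?) (hD : j = P.length + 1 → D[s]? = D'[s]?) :
    tupleEntry (P ++ C :: D :: T) j s = tupleEntry (P ++ C' :: D' :: T) j s := by
  rcases lt_or_ge j P.length with hj | hj
  · rw [tupleEntry_append_left hj, tupleEntry_append_left hj]
  · obtain ⟨k, rfl⟩ := Nat.exists_eq_add_of_le hj
    rw [tupleEntry_append_right, tupleEntry_append_right]
    rcases k with _ | _ | k
    · simpa [tupleEntry_cons_zero] using hC rfl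
    · simpa [tupleEntry_cons_zero, tupleEntry_cons_succ] using hD rfl
    · simp [tupleEntry_cons_succ]

theorem tupleFailsAt_length (P T : List (List A)) (C D : List A) (s : ℕ) :
    TupleFailsAt G (P ++ C :: D :: T) s P.length ↔ FailsAt G s C D := by
  have h0 := tupleEntry_append_right P (C :: D :: T) 0 s
  rw [add_zero] at h0
  rw [TupleFailsAt, tupleEntry_append_right, h0, tupleEntry_cons_succ, tupleEntry_cons_zero,
    tupleEntry_cons_zero, FailsAt]

theorem tupleFailsAt_take {P T : List (List A)} {C D : List A} {r s j : ℕ}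
    (h : s < r ∨ s = r ∧ P.length < j) :
    TupleFailsAt G (P ++ C :: D :: T) s j ↔
      TupleFailsAt G (P ++ C.take r :: D.take (r + 1) :: T) s j := by
  rw [TupleFailsAt, TupleFailsAt,
    tupleEntry_congr (C := C) (C' := C.take r) (D := D) (D' := D.take (r + 1)) (j := j + 1),
    tupleEntry_congr (C := C) (C' := C.take r) (D := D) (D' := D.take (r + 1)) (j := j)]
  all_goals
    intro hj
    rw [List.getElem?_take_of_lt (by omega)]

/-- This is why the topmost row and then the rightmost failure are chosen: apart from the failure
between `C` and `D`, the selection sees only entries untouched by the exchange. In row `r` it looks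
only to the right, hence at the entry of `D` but not at that of `C`. -/
theorem selectedAt_iff (P T : List (List A)) (C D : List A) (r : ℕ) :
    SelectedAt G r P.length (P ++ C :: D :: T) ↔ FirstFailsAt G r C D ∧
      (∀ s < r, ∀ i, i ≠ P.length →
        ¬ TupleFailsAt G (P ++ C.take r :: D.take (r + 1) :: T) s i) ∧
      ∀ i, P.length < i → ¬ TupleFailsAt G (P ++ C.take r :: D.take (r + 1) :: T) r i := by
  rw [SelectedAt, FirstFailsAt, tupleFailsAt_length, and_assoc, ← and_assoc (a := ∀ s < r, _)]
  refine and_congr_right fun _ => and_congr ⟨fun h => ⟨fun s hs => ?_, fun s hs i _ => ?_⟩,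
    fun h s hs i => ?_⟩ (forall₂_congr fun i hi => not_congr (tupleFailsAt_take (.inr ⟨rfl, hi⟩)))
  · exact fun hf => h s hs _ ((tupleFailsAt_length P T C D s).2 hf)
  · rw [← tupleFailsAt_take (.inl hs)]
    exact h s hs i
  · by_cases hi : i = P.length
    · rw [hi, tupleFailsAt_length]
      exact h.1 s hs
    · rw [tupleFailsAt_take (.inl hs)]
      exact h.2 s hs i hi

end

open Classical in
theorem sumTuples_selectedAt_comm (hG : IsColumnOrder G) (hu : KnuthRelations G u) (r : ℕ)
    (L L' : List ℤ) (a b : ℤ) :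
    (sumTuples G (L ++ a :: b :: L') fun Cs =>
      if SelectedAt G r L.length Cs then tupleProd u Cs else 0) =
    sumTuples G (L ++ (b - 1) :: (a + 1) :: L') fun Cs =>
      if SelectedAt G r L.length Cs then tupleProd u Cs else 0 := by
  rw [sumTuples_append, sumTuples_append]
  refine sumTuples_congr fun P hP => ?_
  obtain rfl : L = P.map fun C => (C.length : ℤ) := hP.symm
  simp only [sumTuples_cons, sumColumnsInt_sumTuples]
  refine sumTuples_congr fun T _ => ?_
  obtain ⟨K, hK⟩ : ∃ K : List A → List A → Prop, ∀ C D,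
      (SelectedAt G r P.length (P ++ C :: D :: T) ↔
        FirstFailsAt G r C D ∧ K (C.take r) (D.take (r + 1))) :=
    ⟨fun C' D' => (∀ s < r, ∀ i, i ≠ P.length → ¬ TupleFailsAt G (P ++ C' :: D' :: T) s i) ∧
      ∀ i, P.length < i → ¬ TupleFailsAt G (P ++ C' :: D' :: T) r i,
      fun C D => selectedAt_iff P T C D r⟩
  have key : ∀ C D : List A, (if SelectedAt G r (P.map fun C => (C.length : ℤ)).length
      (P ++ C :: D :: T) then tupleProd u (P ++ C :: D :: T) else 0) =
      tupleProd u P * ((if FirstFailsAt G r C D ∧ K (C.take r) (D.take (r + 1))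
      then columnProd u C * columnProd u D else 0) * tupleProd u T) := by
    intro C D
    rw [List.length_map]
    simp only [hK, ite_mul, mul_ite, zero_mul, mul_zero]
    simp only [tupleProd, List.map_append, List.map_cons, List.prod_append, List.prod_cons,
      mul_assoc]
  simp only [key, sumColumnsInt_mul_left, sumColumnsInt_mul_right]
  rw [sumColumnsInt_firstFailsAt_comm hG hu]

theorem exists_ofFn_split {t i : ℕ} (hi : i + 1 < t) {f f' : Fin t → ℤ}
    (h : ∀ j : Fin t, (j : ℕ) ≠ i → (j : ℕ) ≠ i + 1 → f j = f' j) :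
    ∃ L L' : List ℤ, L.length = i ∧
      List.ofFn f = L ++ f ⟨i, by omega⟩ :: f ⟨i + 1, hi⟩ :: L' ∧
      List.ofFn f' = L ++ f' ⟨i, by omega⟩ :: f' ⟨i + 1, hi⟩ :: L' := by
  have split : ∀ g : Fin t → ℤ, List.ofFn g = (List.ofFn g).take i ++
      g ⟨i, by omega⟩ :: g ⟨i + 1, hi⟩ :: (List.ofFn g).drop (i + 2) := fun g => by
    conv_lhs => rw [← List.take_append_drop i (List.ofFn g)]
    rw [List.drop_eq_getElem_cons (by simp; omega), List.drop_eq_getElem_cons (by simp; omega)]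
    simp
  have e1 : (List.ofFn f).take i = (List.ofFn f').take i := by
    refine List.ext_getElem (by simp) fun n h1 h2 => ?_
    simp only [List.length_take, List.length_ofFn, lt_min_iff] at h1
    simp only [List.getElem_take, List.getElem_ofFn]
    exact h _ (by simp; omega) (by simp; omega)
  have e2 : (List.ofFn f).drop (i + 2) = (List.ofFn f').drop (i + 2) := by
    refine List.ext_getElem (by simp) fun n h1 h2 => ?_
    simp only [List.getElem_drop, List.getElem_ofFn]
    exact h _ (by simp; omega) (by simp; omega)
  refine ⟨(List.ofFn f).take i, (List.ofFn f).drop (i + 2), by simp; omega, split f, ?_⟩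
  rw [e1, e2]
  exact split f'

-- The involution multiplies `σ` by the transposition of `i` and `i + 1`. It flips the sign and
-- keeps the sum over tuples selected at `(r, i)`.
open Classical in
theorem sum_sign_selectedAt (hG : IsColumnOrder G) (hu : KnuthRelations G u) {t : ℕ}
    (γ : Fin t → ℤ) (r i : ℕ) :
    ∑ σ : Equiv.Perm (Fin t), ((Equiv.Perm.sign σ : ℤˣ) : ℤ) •
      (sumTuples G (List.ofFn fun j => γ (σ j) + (j : ℕ)) fun Cs =>
        if SelectedAt G r i Cs then tupleProd u Cs else 0) = 0 := by
  by_cases hi : i + 1 < t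
  · have hne : (⟨i, by omega⟩ : Fin t) ≠ ⟨i + 1, hi⟩ := by simp
    refine Finset.sum_involution (fun σ _ => σ * Equiv.swap (⟨i, by omega⟩ : Fin t) ⟨i + 1, hi⟩)
      (fun σ _ => ?_) (fun σ _ _ h => ?_) (fun σ _ => Finset.mem_univ _) (fun σ _ => ?_)
    · obtain ⟨L, L', hL, h1, h2⟩ := exists_ofFn_split hi (f := fun j => γ (σ j) + (j : ℕ))
        (f' := fun j => γ ((σ * Equiv.swap (⟨i, by omega⟩ : Fin t) ⟨i + 1, hi⟩) j) + (j : ℕ))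
        (fun j h1 h2 => by
          simp only [Equiv.Perm.mul_apply]
          rw [Equiv.swap_apply_of_ne_of_ne] <;> rw [Ne, Fin.ext_iff] <;> assumption)
      rw [h1, h2]
      subst hL
      -- With `a = γ (σ i) + i` and `b = γ (σ (i + 1)) + i + 1`, the transposed permutation has
      -- lengths `b - 1` and `a + 1` in these two places.
      rw [sumTuples_selectedAt_comm hG hu]
      simp only [Equiv.Perm.mul_apply, Equiv.swap_apply_left, Equiv.swap_apply_right,
        Equiv.Perm.sign_mul, Equiv.Perm.sign_swap hne]
      push_cast
      have e1 : γ (σ ⟨L.length + 1, hi⟩) + ((L.length : ℤ) + 1) - 1 =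
        γ (σ ⟨L.length + 1, hi⟩) + (L.length : ℤ) := by ring
      have e2 : γ (σ ⟨L.length, by omega⟩) + (L.length : ℤ) + 1 =
        γ (σ ⟨L.length, by omega⟩) + ((L.length : ℤ) + 1) := by ring
      rw [e1, e2, mul_neg, mul_one, neg_smul, add_neg_cancel]
    · exact hne (Equiv.swap_eq_one_iff.1 (mul_eq_left.1 h))
    · simp [mul_assoc]
  · refine Finset.sum_eq_zero fun σ _ => ?_
    rw [sumTuples_congr (F' := fun _ => 0), sumTuples_const_zero, smul_zero]
    intro Cs hCs
    refine if_neg fun hs => hi ?_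
    have := hs.1.bound.1
    have hl := congrArg List.length hCs
    simp at hl
    omega

theorem exists_lt_of_ne_one {t : ℕ} {σ : Equiv.Perm (Fin t)} (hσ : σ ≠ 1) :
    ∃ i, ∃ hi : i + 1 < t, σ ⟨i + 1, hi⟩ < σ ⟨i, by omega⟩ := by
  by_contra! h
  apply hσ
  cases t with
  | zero => exact Subsingleton.elim _ _
  | succ n =>
    have hm : StrictMono σ := Fin.strictMono_iff_lt_succ.2 fun i =>
      lt_of_le_of_ne (h i (by omega)) fun e => by
        have := σ.injective e
        simp [Fin.ext_iff] at this
    have h1 := (hm.range_inj strictMono_id).1 (by simp)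
    exact Equiv.ext fun i => congrFun h1 i

-- An entry with no left neighbour counts as a failure, so the row condition already includes that
-- the lengths form a partition.
omit [Fintype A] [DecidableRel G] in
theorem IsTableauTuple.length_le {Cs : List (List A)} (h : IsTableauTuple G Cs) {i : ℕ}
    (hi : i + 1 < Cs.length) : Cs[i + 1].length ≤ Cs[i].length := by
  by_contra! hlt
  refine h Cs[i].length i ⟨Cs[i + 1][Cs[i].length], ?_, ?_⟩
  · simp [tupleEntry, List.getElem?_eq_getElem hi, List.getElem?_eq_getElem hlt]
  · simp [tupleEntry, List.getElem?_eq_getElem (Nat.lt_of_succ_lt hi)]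

open Classical in
theorem sum_sign_prod_eq_sumTuples (hG : IsColumnOrder G) (hu : KnuthRelations G u) {t : ℕ}
    {γ : Fin t → ℤ} (hγ : StrictAnti γ) :
    ∑ σ : Equiv.Perm (Fin t), ((Equiv.Perm.sign σ : ℤˣ) : ℤ) •
      (List.ofFn fun j => sumColumnsInt G (γ (σ j) + (j : ℕ)) (columnProd u)).prod =
    sumTuples G (List.ofFn fun j => γ j + (j : ℕ)) fun Cs =>
      if IsTableauTuple G Cs then tupleProd u Cs else 0 := by
  -- A bound on the column lengths that is valid for every `σ`, so that the sum over rows can be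
  -- exchanged with the sum over permutations.
  set M : ℕ := ∑ j, (γ j).natAbs + t with hM
  have hprod : ∀ σ : Equiv.Perm (Fin t),
      (List.ofFn fun j => sumColumnsInt G (γ (σ j) + (j : ℕ)) (columnProd u)).prod =
      (sumTuples G (List.ofFn fun j => γ (σ j) + (j : ℕ)) fun Cs =>
        if IsTableauTuple G Cs then tupleProd u Cs else 0) +
      ∑ r ∈ Finset.range M, ∑ i ∈ Finset.range t,
        sumTuples G (List.ofFn fun j => γ (σ j) + (j : ℕ)) fun Cs =>
          if SelectedAt G r i Cs then tupleProd u Cs else 0 := by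
    intro σ
    simp only [← sumTuples_sum, ← sumTuples_add]
    have := sumTuples_tupleProd (G := G) (u := u) (List.ofFn fun j => γ (σ j) + (j : ℕ))
    rw [List.map_ofFn] at this
    refine this.symm.trans (sumTuples_congr fun Cs hCs => ?_)
    refine sum_selectedAt ?_ (fun C hC => ?_) _
    · have hl := congrArg List.length hCs
      simp at hl
      omega
    · have hmem : (C.length : ℤ) ∈ List.ofFn fun j => γ (σ j) + ((j : ℕ) : ℤ) :=
        hCs ▸ List.mem_map_of_mem hC
      obtain ⟨j, hj⟩ := List.mem_ofFn.1 hmem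
      have := Finset.single_le_sum (f := fun j => (γ j).natAbs) (fun _ _ => Nat.zero_le _)
        (Finset.mem_univ (σ j))
      have := j.isLt
      omega
  simp only [hprod, smul_add, Finset.sum_add_distrib, Finset.smul_sum]
  rw [Finset.sum_comm (s := Finset.univ (α := Equiv.Perm (Fin t))),
    Finset.sum_eq_zero (s := Finset.range M), add_zero]
  · rw [Finset.sum_eq_single 1]
    · simp
    -- At a descent of `σ` the value of `γ` rises, so column `i + 1` would be longer than column
    -- `i`, which a tableau forbids.
    · intro σ _ hσ
      obtain ⟨i, hi, hlt⟩ := exists_lt_of_ne_one hσ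
      rw [sumTuples_congr (F' := fun _ => 0), sumTuples_const_zero, smul_zero]
      intro Cs hCs
      refine if_neg fun hT => ?_
      have hl : Cs.length = t := by simpa using congrArg List.length hCs
      have hle := hT.length_le (i := i) (by omega)
      have hget : ∀ j (hj : j < t), ((Cs[j]).length : ℤ) = γ (σ ⟨j, hj⟩) + j := fun j hj => by
        have := congrArg (fun L => L[j]?) hCs
        simpa [hl ▸ hj, hj] using this
      have h1 := hget i (by omega)
      have h2 := hget (i + 1) hi
      have h3 := hγ hlt
      push_cast at h2
      omega
    · simp
  · intro r _
    rw [Finset.sum_comm]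
    exact Finset.sum_eq_zero fun i _ => sum_sign_selectedAt hG hu γ r i

end Tuples
-- Nested column sums as sums over functions.
section Fillings

variable {A Q : Type*} [Fintype A] [Ring Q] {G : A → A → Prop} [DecidableRel G] {u : A → Q}

open Classical in
theorem sumColumns_eq_sum (k : ℕ) (S : Finset A) (F : List A → Q) :
    sumColumns G k S F = ∑ z : Fin k → A,
      if (List.ofFn z).IsChain (fun a b => G b a) ∧ ∀ c ∈ (List.ofFn z).head?, c ∈ S
      then F (List.ofFn z) else 0 := by
  induction k generalizing S F with
  | zero => simp
  | succ k ih =>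
    rw [sumColumns_succ, ← (Fin.consEquiv fun _ => A).sum_comp, Fintype.sum_prod_type,
      ← Finset.sum_subset (Finset.subset_univ S)]
    · refine Finset.sum_congr rfl fun x hx => ?_
      rw [ih]
      refine Finset.sum_congr rfl fun z _ => ?_
      simp only [Fin.consEquiv, Equiv.coe_fn_mk, List.ofFn_cons, List.isChain_cons, mem_below,
        List.head?_cons, Option.mem_some_iff, forall_eq', hx, and_true]
      simp only [and_comm]
    · intro x _ hx
      refine Finset.sum_eq_zero fun z _ => if_neg fun h => hx (h.2 x ?_)
      simp [Fin.consEquiv]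

open Classical in
theorem sumColumns_univ_eq_sum (k : ℕ) (F : List A → Q) :
    sumColumns G k Finset.univ F = ∑ z : Fin k → A,
      if (List.ofFn z).IsChain (fun a b => G b a) then F (List.ofFn z) else 0 := by
  simp [sumColumns_eq_sum]

open Classical in
theorem sumTuples_eq_sum {t : ℕ} (k : Fin t → ℕ) (F : List (List A) → Q) :
    sumTuples G (List.ofFn fun j => (k j : ℤ)) F = ∑ C : ∀ j, Fin (k j) → A,
      if ∀ j, (List.ofFn (C j)).IsChain (fun a b => G b a)
      then F (List.ofFn fun j => List.ofFn (C j)) else 0 := by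
  induction t generalizing F with
  | zero => simp
  | succ t ih =>
    rw [List.ofFn_succ, sumTuples_cons, sumColumnsInt_natCast, sumColumns_univ_eq_sum,
      ← (Fin.consEquiv fun j => Fin (k j) → A).sum_comp, Fintype.sum_prod_type]
    refine Finset.sum_congr rfl fun z _ => ?_
    rw [ih fun j => k j.succ]
    by_cases hz : (List.ofFn z).IsChain fun a b => G b a
    · rw [if_pos hz]
      refine Finset.sum_congr rfl fun C _ => ?_
      simp [Fin.consEquiv, Fin.forall_fin_succ, List.ofFn_succ, hz]
    · rw [if_neg hz]
      refine (Finset.sum_eq_zero fun C _ => if_neg fun h => hz ?_).symm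
      simpa [Fin.consEquiv] using h 0

end Fillings

theorem ofFn_rev {A : Type*} {k : ℕ} (z : Fin k → A) :
    List.ofFn (fun i => z i.rev) = (List.ofFn z).reverse := by
  refine List.ext_getElem (by simp) fun n h1 h2 => ?_
  simp [Fin.rev, Nat.sub_sub, Nat.add_comm 1]

/-! ### Specialization to the colored plactic algebra. -/

section Plactic

variable {N : ℕ} {lt : Letter N → Letter N → Prop}

theorem IsShuffleOrder.asymm (hlt : IsShuffleOrder lt) {x y : Letter N} (h : lt x y) :
    ¬ lt y x := fun h' => hlt.irrefl x (hlt.trans _ _ _ h h')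

theorem IsShuffleOrder.not_colGT_iff (hlt : IsShuffleOrder lt) {x y : Letter N} :
    ¬ ColGT lt x y ↔ lt x y ∨ x = y ∧ x.isLeft = true := by
  constructor
  · intro h
    rcases hlt.total x y with h' | rfl | h'
    · exact .inl h'
    · refine .inr ⟨rfl, ?_⟩
      have h1 : ¬ x.isRight = true := fun hr => h (.inr ⟨rfl, hr⟩)
      cases x <;> simp_all
    · exact (h (.inl h')).elim
  · rintro (h | ⟨rfl, h⟩) (h' | ⟨h', h''⟩)
    · exact hlt.asymm h h'
    · exact hlt.irrefl _ (h' ▸ h)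
    · exact hlt.irrefl _ h'
    · cases x <;> simp_all

theorem IsShuffleOrder.isColumnOrder (hlt : IsShuffleOrder lt) : IsColumnOrder (ColGT lt) where
  trans := by
    rintro x y z (h | ⟨rfl, h⟩) (h' | ⟨rfl, h'⟩)
    · exact .inl (hlt.trans _ _ _ h' h)
    · exact .inl h
    · exact .inl h'
    · exact .inr ⟨rfl, h⟩
  cotrans := by
    intro x y z
    rw [hlt.not_colGT_iff, hlt.not_colGT_iff, hlt.not_colGT_iff]
    rintro (h | ⟨rfl, h⟩) (h' | ⟨rfl, h'⟩)
    · exact .inl (hlt.trans _ _ _ h h')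
    · exact .inl h
    · exact .inl h'
    · exact .inr ⟨rfl, h⟩
  antisymm := by
    rintro x y (h | ⟨rfl, h⟩) (h' | ⟨h', -⟩)
    · exact (hlt.asymm h h').elim
    · exact h'.symm
    · rfl
    · rfl
  connected := by
    intro x y hne
    rcases hlt.total x y with h | h | h
    · exact .inr (.inl h)
    · exact (hne h).elim
    · exact .inl (.inl h)

theorem toPlactic_monomial (w : ColoredWord N) :
    toPlactic lt (monomial w) = wordProd (fun x => toPlactic lt (FreeAlgebra.ι ℤ x)) w := by
  rw [monomial, map_list_prod, List.map_map, wordProd]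
  rfl

/-- Strict inequalities give the two generic plactic relations. An equality in `ColGT` forces a
barred letter and one in its negation an unbarred letter, which gives the four remaining relations.
-/
theorem IsShuffleOrder.knuthRelations (hlt : IsShuffleOrder lt) :
    KnuthRelations (ColGT lt) fun x => toPlactic lt (FreeAlgebra.ι ℤ x) := by
  have rel : ∀ v w : ColoredWord N, PlacticRel lt (monomial v) (monomial w) →
      wordProd (fun x => toPlactic lt (FreeAlgebra.ι ℤ x)) v =
        wordProd (fun x => toPlactic lt (FreeAlgebra.ι ℤ x)) w := fun v w h => by
    rw [← toPlactic_monomial, ← toPlactic_monomial]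
    exact RingQuot.mkAlgHom_rel ℤ h
  constructor
  · intro x y z hxy hzy
    suffices h : PlacticRel lt (monomial [x, z, y]) (monomial [z, x, y]) ∨
        PlacticRel lt (monomial [z, x, y]) (monomial [x, z, y]) by
      rcases h with h | h
      · simpa [mul_assoc] using rel _ _ h
      · simpa [mul_assoc] using (rel _ _ h).symm
    rw [hlt.not_colGT_iff] at hxy
    rcases hxy with hxy | ⟨rfl, hx⟩
    · rcases hzy with hzy | ⟨rfl, hz⟩
      · exact .inl (.xzy_zxy _ _ _ hxy hzy)
      · obtain ⟨b, rfl⟩ := Sum.isRight_iff.1 hz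
        exact .inl (.barred_xyy _ _ hxy)
    · obtain ⟨b, rfl⟩ := Sum.isLeft_iff.1 hx
      rcases hzy with hzy | ⟨rfl, hz⟩
      · exact .inr (.unbarred_zyy _ _ hzy)
      · simp at hz
  · intro x y z hyx hyz
    suffices h : PlacticRel lt (monomial [y, x, z]) (monomial [y, z, x]) ∨
        PlacticRel lt (monomial [y, z, x]) (monomial [y, x, z]) by
      rcases h with h | h
      · simpa [mul_assoc] using rel _ _ h
      · simpa [mul_assoc] using (rel _ _ h).symm
    rw [hlt.not_colGT_iff] at hyz
    rcases hyz with hyz | ⟨rfl, hy⟩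
    · rcases hyx with hyx | ⟨rfl, hz⟩
      · exact .inl (.yxz_yzx _ _ _ hyx hyz)
      · obtain ⟨b, rfl⟩ := Sum.isRight_iff.1 hz
        exact .inl (.barred_yyz _ _ hyz)
    · obtain ⟨b, rfl⟩ := Sum.isLeft_iff.1 hy
      rcases hyx with hyx | ⟨rfl, hz⟩
      · exact .inr (.unbarred_yyx _ _ hyx)
      · simp at hz

open Classical in
theorem toPlactic_elementary (k : ℤ) :
    toPlactic lt (elementary lt k) = sumColumnsInt (ColGT lt) k
      (columnProd fun x => toPlactic lt (FreeAlgebra.ι ℤ x)) := by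
  cases k with
  | negSucc k => simp [elementary, sumColumnsInt]
  | ofNat k =>
    rw [sumColumnsInt, sumColumns_univ_eq_sum, elementary, map_sum, Finset.sum_filter,
      -- Words of `elementary` run from bottom to top, columns from top to bottom.
      ← (Equiv.arrowCongr Fin.revPerm (Equiv.refl (Letter N))).sum_comp]
    refine Finset.sum_congr rfl fun z _ => ?_
    have hz : List.ofFn (Equiv.arrowCongr Fin.revPerm (Equiv.refl (Letter N)) z) =
        (List.ofFn z).reverse := by
      exact ofFn_rev z
    rw [hz, toPlactic_monomial, columnProd_eq]
    simp only [List.isChain_reverse]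

/-- The filling of a Young diagram as a tuple of columns. -/
def columnsEquiv {A : Type*} (ν : YoungDiagram) :
    (ν.cells → A) ≃ (∀ j : Fin (ν.rowLen 0), Fin (ν.colLen j) → A) where
  toFun T j i := T ⟨(i, j), YoungDiagram.mem_iff_lt_colLen.2 i.isLt⟩
  invFun C c := C ⟨c.1.2, YoungDiagram.mem_iff_lt_rowLen.1
      (ν.up_left_mem (Nat.zero_le c.1.1) le_rfl c.2)⟩
    ⟨c.1.1, YoungDiagram.mem_iff_lt_colLen.1 c.2⟩
  left_inv _ := rfl
  right_inv _ := rfl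

theorem tupleFailsAt_columnsEquiv {A : Type*} {G : A → A → Prop} {ν : YoungDiagram}
    (T : ν.cells → A) (s j : ℕ) :
    TupleFailsAt G (List.ofFn fun j => List.ofFn (columnsEquiv ν T j)) s j ↔
      ∃ h : (s, j + 1) ∈ ν.cells,
        G (T ⟨(s, j), ν.up_left_mem le_rfl (Nat.le_succ j) h⟩) (T ⟨(s, j + 1), h⟩) := by
  have entry : ∀ j, tupleEntry (List.ofFn fun j => List.ofFn (columnsEquiv ν T j)) j s =
      if h : (s, j) ∈ ν.cells then some (T ⟨(s, j), h⟩) else none := by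
    intro j
    by_cases h : (s, j) ∈ ν.cells
    · have h1 : j < ν.rowLen 0 := YoungDiagram.mem_iff_lt_rowLen.1
        (ν.up_left_mem (Nat.zero_le s) le_rfl h)
      have h2 : s < ν.colLen j := YoungDiagram.mem_iff_lt_colLen.1 h
      rw [dif_pos h]
      simp [tupleEntry, h1, h2, columnsEquiv]
    · rw [dif_neg h, tupleEntry, Option.bind_eq_none_iff]
      intro C hC
      obtain ⟨h1, rfl⟩ := List.getElem?_eq_some_iff.1 hC
      have h2 : ¬ s < ν.colLen j := fun h' => h (YoungDiagram.mem_iff_lt_colLen.2 h')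
      simpa using h2
  rw [TupleFailsAt, entry, entry]
  by_cases h : (s, j + 1) ∈ ν.cells
  · have h' : (s, j) ∈ ν.cells := ν.up_left_mem le_rfl (Nat.le_succ j) h
    simp only [dif_pos h, dif_pos h', Option.mem_some_iff, exists_eq_left', forall_eq']
    exact ⟨fun hg => ⟨h, hg⟩, fun ⟨_, hg⟩ => hg⟩
  · simp [h]

/-- The tuple condition concerns adjacent columns only; `cotrans` propagates it along a row. -/
theorem isTableauTuple_columnsEquiv {A : Type*} {G : A → A → Prop} (hG : IsColumnOrder G)
    {ν : YoungDiagram} (T : ν.cells → A) :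
    IsTableauTuple G (List.ofFn fun j => List.ofFn (columnsEquiv ν T j)) ↔
      ∀ c d : ν.cells, c.1.1 = d.1.1 → c.1.2 < d.1.2 → ¬ G (T c) (T d) := by
  simp only [IsTableauTuple, tupleFailsAt_columnsEquiv, not_exists]
  constructor
  · intro h
    have key : ∀ s j j', j + 1 ≤ j' → ∀ (hj : (s, j) ∈ ν.cells) (hj' : (s, j') ∈ ν.cells),
        ¬ G (T ⟨(s, j), hj⟩) (T ⟨(s, j'), hj'⟩) := by
      intro s j j' hjj'
      induction j', hjj' using Nat.le_induction with
      | base => exact fun _ hj' => h s j hj'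
      | succ k _ ih =>
        intro hj hj'
        have hk : (s, k) ∈ ν.cells := ν.up_left_mem le_rfl (Nat.le_succ k) hj'
        exact hG.cotrans (ih hj hk) (h s k hj')
    rintro ⟨⟨s, j⟩, hc⟩ ⟨⟨s', j'⟩, hd⟩ hs hj
    obtain rfl : s = s' := hs
    exact key s j j' hj hc hd
  · exact fun h s j hj => h _ _ rfl (Nat.lt_succ_self j)

theorem isChain_columnsEquiv {A : Type*} {G : A → A → Prop} (hG : IsColumnOrder G)
    {ν : YoungDiagram} (T : ν.cells → A) :
    (∀ j, (List.ofFn (columnsEquiv ν T j)).IsChain fun a b => G b a) ↔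
      ∀ c d : ν.cells, c.1.2 = d.1.2 → c.1.1 < d.1.1 → G (T d) (T c) := by
  have : Trans (fun a b => G b a) (fun a b => G b a) fun a b => G b a :=
    ⟨fun h h' => hG.trans h' h⟩
  simp only [List.isChain_iff_pairwise, List.pairwise_ofFn]
  constructor
  · rintro h ⟨⟨i, j⟩, hc⟩ ⟨⟨i', j'⟩, hd⟩ hj hi
    obtain rfl : j = j' := hj
    exact @h ⟨j, YoungDiagram.mem_iff_lt_rowLen.1 (ν.up_left_mem (Nat.zero_le i) le_rfl hc)⟩
      ⟨i, YoungDiagram.mem_iff_lt_colLen.1 hc⟩ ⟨i', YoungDiagram.mem_iff_lt_colLen.1 hd⟩ hi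
  · exact fun h j i i' hi => h _ _ rfl hi

theorem isColoredTableau_iff (hlt : IsShuffleOrder lt) {ν : YoungDiagram}
    (T : ν.cells → Letter N) :
    IsColoredTableau lt ν T ↔
      (∀ j, (List.ofFn (columnsEquiv ν T j)).IsChain fun a b => ColGT lt b a) ∧
        IsTableauTuple (ColGT lt) (List.ofFn fun j => List.ofFn (columnsEquiv ν T j)) := by
  rw [isTableauTuple_columnsEquiv hlt.isColumnOrder, isChain_columnsEquiv hlt.isColumnOrder]
  constructor
  · intro h
    refine ⟨fun c d hj hi => ?_, fun c d hi hj => hlt.not_colGT_iff.2 ?_⟩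
    · rcases h.col_weak c d hj hi with h' | h'
      · exact .inl h'
      · refine .inr ⟨h'.symm, ?_⟩
        by_contra hr
        have hl : (T d).isLeft = true := by simpa using hr
        exact hlt.irrefl _ (h' ▸ h.col_strict c d hj hi (h' ▸ hl) hl)
    · rcases h.row_weak c d hi hj with h' | h'
      · exact .inl h'
      · refine .inr ⟨h', ?_⟩
        by_contra hl
        have hr : (T c).isRight = true := by simpa using hl
        exact hlt.irrefl _ (h' ▸ h.row_strict c d hi hj hr (h' ▸ hr))
  · rintro ⟨hcol, hrow⟩
    simp only [hlt.not_colGT_iff] at hrow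
    refine ⟨fun c d hi hj => (hrow c d hi hj).imp id And.left,
      fun c d hj hi => (hcol c d hj hi).imp id fun h => h.1.symm,
      fun c d hi hj hc _ => (hrow c d hi hj).resolve_right fun h => ?_,
      fun c d hj hi _ hd => (hcol c d hj hi).resolve_right fun h => ?_⟩
    · exact (by simpa using h.2 : ¬ (T c).isRight = true) hc
    · exact (by simpa using h.2 : ¬ (T d).isLeft = true) hd

theorem toPlactic_columnReading {ν : YoungDiagram} (T : ν.cells → Letter N) :
    toPlactic lt (monomial (columnReading T)) =
      tupleProd (fun x => toPlactic lt (FreeAlgebra.ι ℤ x))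
        (List.ofFn fun j => List.ofFn (columnsEquiv ν T j)) := by
  rw [toPlactic_monomial, wordProd, columnReading, List.map_flatten, List.prod_flatten,
    tupleProd, List.map_ofFn, List.map_ofFn, List.map_ofFn]
  congr 2
  funext j
  simp only [Function.comp_apply, columnProd_eq, ← ofFn_rev]
  rfl

theorem toPlactic_superSchur (ν : YoungDiagram) :
    toPlactic lt (superSchur lt ν) = ∑ π : Equiv.Perm (Fin (ν.rowLen 0)),
      ((Equiv.Perm.sign π : ℤˣ) : ℤ) • (List.ofFn fun j => toPlactic lt
        (elementary lt ((ν.colLen j : ℤ) + ((π j : ℕ) : ℤ) - ((j : ℕ) : ℤ)))).prod := by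
  rw [superSchur, map_sum]
  refine Finset.sum_congr rfl fun π _ => ?_
  rw [map_zsmul, map_list_prod, List.map_ofFn]
  rfl

theorem toPlactic_elementary_commute (hlt : IsShuffleOrder lt) (k l : ℤ) :
    Commute (toPlactic lt (elementary lt k)) (toPlactic lt (elementary lt l)) := by
  cases k with
  | negSucc k => simp [elementary]
  | ofNat k =>
    cases l with
    | negSucc l => simp [elementary]
    | ofNat l =>
      classical
      simp only [toPlactic_elementary, sumColumnsInt, sumColumns_columnProd]
      exact columnSum_commute hlt.isColumnOrder hlt.knuthRelations _
        (fun _ _ => Finset.subset_univ _) k l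

/-- Substituting `π = σ⁻¹` and commuting the factors attaches the shift `j` to the position of a
factor and `γ` to the permuted index, so that an adjacent transposition of positions has the effect
used in the cancellation. -/
theorem toPlactic_superSchur_reorder (hlt : IsShuffleOrder lt) (ν : YoungDiagram) :
    toPlactic lt (superSchur lt ν) = ∑ σ : Equiv.Perm (Fin (ν.rowLen 0)),
      ((Equiv.Perm.sign σ : ℤˣ) : ℤ) • (List.ofFn fun j => toPlactic lt
        (elementary lt ((ν.colLen (σ j) : ℤ) - ((σ j : ℕ) : ℤ) + ((j : ℕ) : ℤ)))).prod := by
  rw [toPlactic_superSchur,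
    ← Equiv.sum_comp (Equiv.inv (Equiv.Perm (Fin (ν.rowLen 0))))]
  refine Finset.sum_congr rfl fun σ _ => ?_
  rw [Equiv.inv_apply, Equiv.Perm.sign_inv]
  congr 1
  refine ((Equiv.Perm.ofFn_comp_perm σ _).prod_eq' ?_).symm.trans ?_
  · rw [List.pairwise_ofFn]
    exact fun _ _ _ => toPlactic_elementary_commute hlt _ _
  · congr 2
    funext j
    have : σ⁻¹ (σ j) = j := σ.symm_apply_apply j
    rw [Function.comp_apply, this]
    congr 2
    ring

end Plactic

end SuperSchur

theorem theorem3p5 {N : ℕ} (lt : SuperSchur.Letter N → SuperSchur.Letter N → Prop)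
    (hlt : SuperSchur.IsShuffleOrder lt) (ν : YoungDiagram) :
    SuperSchur.toPlactic lt (SuperSchur.superSchur lt ν) =
      ∑ T ∈ SuperSchur.coloredTableaux lt ν,
        SuperSchur.toPlactic lt (SuperSchur.monomial (SuperSchur.columnReading T)) := by
  classical
  -- Column lengths decrease weakly, and subtracting the index makes the decrease strict.
  have hγ : StrictAnti fun j : Fin (ν.rowLen 0) => (ν.colLen j : ℤ) - ((j : ℕ) : ℤ) := by
    intro i j hij
    have h1 := ν.colLen_anti i j hij.le
    have h2 : (i : ℕ) < j := hij
    simp only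
    omega
  have key := SuperSchur.sum_sign_prod_eq_sumTuples hlt.isColumnOrder hlt.knuthRelations hγ
  rw [SuperSchur.toPlactic_superSchur_reorder hlt]
  simp only [SuperSchur.toPlactic_elementary]
  refine key.trans ?_
  simp only [sub_add_cancel]
  rw [SuperSchur.sumTuples_eq_sum, ← (SuperSchur.columnsEquiv ν).sum_comp,
    SuperSchur.coloredTableaux, Finset.sum_filter]
  refine Finset.sum_congr rfl fun T _ => ?_
  simp only [SuperSchur.isColoredTableau_iff hlt, SuperSchur.toPlactic_columnReading, ite_and]
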